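/- Let $m\ge 1$ be an integer. There exist constants $A_m,B_m,C_m\in(0,\infty)$, depending only on $m$, with the following property. Let $(\mathbb H,\langle\cdot,\cdot\rangle)$ be a separable Hilbert space, let $(S,\mathcal S)$ be a measurable space, let $(\xi_i)_{i\ge 1}$ be an i.i.d. sequence of random elements of $S$, and for every $\mathbf i=(i_1,\dots,i_m)\in\mathbb N^m$ with $1\le i_1<\dots<i_m$ let $h_{\mathbf i}\colon S^m\to\mathbb H$ be measurable for the product $\sigma$-algebra. Assume that the kernels are degenerate: for every such $\mathbf i$ the random element $h_{\mathbf i}(\xi_1,\dots,\xi_m)$ is integrable, and for every $j_0\in\{1,\dots,m\}$ $$\mathbb E\bigl[h_{\mathbf i}(\xi_1,\dots,\xi_m)\,\big|\,\sigma(\xi_j,\ 1\le j\le m,\ j\ne j_0)\bigr]=0\quad\text{a.s.}$$ For $n\ge m$ let $\mathrm{Inc}^m_n=\{\mathbf i\in\mathbb N^m: 1\le i_1<\dots<i_m\le n\}$ and $\xi_{\mathbf i}=(\xi_{i_1},\dots,\xi_{i_m})$. Let $(\xi^{(\ell)}_i)_{i\ge1}$, $1\le\ell\le m$, be mutually independent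 sequences, each with the same law as the sequence $(\xi_i)_{i\ge1}$, and let $\xi^{\mathrm{dec}}_{\mathbf i}=(\xi^{(1)}_{i_1},\dots,\xi^{(m)}_{i_m})$. Then for every integer $N\ge m$ and all real $x,y>0$, $$\mathbb P\Bigl(\max_{m\le n\le N}\Bigl\|\sum_{\mathbf i\in\mathrm{Inc}^m_n}h_{\mathbf i}(\xi_{\mathbf i})\Bigr\|_{\mathbb H}>x\Bigr)\le A_m\exp\Bigl(-\Bigl(\frac xy\Bigr)^{2/m}\Bigr)+B_m\int_1^\infty u\,(1+\log u)^{\frac{m(m+1)}2-1}\;\mathbb P\Bigl(\sqrt{\textstyle\sum_{\mathbf i\in\mathrm{Inc}^m_N}\|h_{\mathbf i}(\xi^{\mathrm{dec}}_{\mathbf i})\|_{\mathbb H}^2}>C_m\,y\,u\Bigr)\,du,$$ where the right-hand side is allowed to be $+\infty$. -/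

import Mathlib

open MeasureTheory ProbabilityTheory

namespace UStat

/-- A sequence of measurable random elements that is independent and identically distributed.
Sequences are indexed from `0`, so `ξ i` is the `(i + 1)`-st random element of the sequence. -/
def IsIID {Ω S : Type*} [MeasurableSpace Ω] [MeasurableSpace S]
    (ξ : ℕ → Ω → S) (P : Measure Ω) : Prop :=
  (∀ i, Measurable (ξ i)) ∧ iIndepFun ξ P ∧ ∀ i, IdentDistrib (ξ i) (ξ 0) P P

/-- `ξdec 0, …, ξdec (m - 1)` are independent copies of the whole sequence `ξ`. They may live on
another probability space (in particular, on the same one). -/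
def IsIndepCopies {Ω Ω' S : Type*} [MeasurableSpace Ω] [MeasurableSpace Ω'] [MeasurableSpace S]
    {m : ℕ} (ξdec : Fin m → ℕ → Ω' → S) (P' : Measure Ω')
    (ξ : ℕ → Ω → S) (P : Measure Ω) : Prop :=
  (∀ l i, Measurable (ξdec l i)) ∧
  iIndepFun (fun (l : Fin m) (ω : Ω') (i : ℕ) => ξdec l i ω) P' ∧
  ∀ l, IdentDistrib (fun (ω : Ω') (i : ℕ) => ξdec l i ω) (fun (ω : Ω) (i : ℕ) => ξ i ω) P' P

open Classical in
/-- The strictly increasing `m`-tuples of indices among the first `n` indices `0, …, n - 1`. -/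
noncomputable def Inc (m n : ℕ) : Finset (Fin m → ℕ) :=
  {i ∈ Fintype.piFinset (fun _ : Fin m => Finset.range n) | StrictMono i}

/-- The sum, over strictly increasing `m`-tuples `i` among the first `n` indices, of
`h i (ξ (i 0), …, ξ (i (m - 1)))`. -/
noncomputable def uStat {Ω S H : Type*} [AddCommMonoid H] {m : ℕ}
    (h : (Fin m → ℕ) → (Fin m → S) → H) (ξ : ℕ → Ω → S) (n : ℕ) (ω : Ω) : H :=
  ∑ i ∈ Inc m n, h i (fun k => ξ (i k) ω)

/-- The square root of the sum, over strictly increasing `m`-tuples `i` among the first `N`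
indices, of the squared norms of the decoupled terms. -/
noncomputable def decNorm {Ω' S H : Type*} [Norm H] {m : ℕ}
    (h : (Fin m → ℕ) → (Fin m → S) → H) (ξdec : Fin m → ℕ → Ω' → S) (N : ℕ) (ω : Ω') : ℝ :=
  Real.sqrt (∑ i ∈ Inc m N, ‖h i (fun k => ξdec k (i k) ω)‖ ^ 2)

/-- Degeneracy: for every strictly increasing `i` and every coordinate `j₀`, the random element
`h i (ξ 0, …, ξ (m - 1))` is integrable and its conditional expectation given
`σ(ξ j, j < m, j ≠ j₀)` vanishes almost surely. -/
def IsDegenerate {Ω S H : Type*} [MeasurableSpace Ω] [mS : MeasurableSpace S]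
    [NormedAddCommGroup H] [NormedSpace ℝ H] [CompleteSpace H] {m : ℕ}
    (h : (Fin m → ℕ) → (Fin m → S) → H) (ξ : ℕ → Ω → S) (P : Measure Ω) : Prop :=
  ∀ i : Fin m → ℕ, StrictMono i →
    Integrable (fun ω => h i (fun k => ξ k ω)) P ∧
    ∀ j₀ : Fin m,
      P[fun ω => h i (fun k => ξ k ω) |
        ⨆ j : {j : Fin m // j ≠ j₀}, MeasurableSpace.comap (ξ (j : Fin m)) mS] =ᵐ[P] 0

end UStat

/-! The proof is a truncated moment method. If `x < y`, the exponential term with `A = 3` already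
exceeds one. Otherwise take `q = ⌈(x / y) ^ (2 / m)⌉` and the convex radial function `φ u = powHuber
(2 * q) x ‖u‖`: it is `‖u‖ ^ (2 * q)` inside the ball of radius `x` and grows linearly outside.
Linear growth and a bounded gradient make every expectation finite although the kernels are only
integrable.

Degeneracy enters solely as orthogonality: a kernel term integrates to zero against any bounded
vector that does not depend on one of its variables (`IsCanonical.integral_inner_eq_zero`). Three
consequences follow from the subgradient inequality for `φ`. A Doob argument bounds `x ^ (2 * q)`
times the probability by `E φ(U)`, with `U` the full sum. Writing `U` as an average over maps `δ`
that sort the variables into `m` classes, Jensen's inequality gives one `δ` for which it suffices to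
keep the terms having their `k`-th variable in class `k`, at the cost of a factor `m ^ m`. For such
sums arbitrary signs can be attached class by class, at the cost of a factor `2` each.

Averaging over the signs leaves, conditionally on the variables, a decoupled Rademacher chaos with
conditional variance `w = ∑ ‖f i‖ ^ 2`, up to the scaling already paid. Its moments of order `2 * q`
(iterated Khintchine) give `exp (-q)` when `w` is at most of order `y ^ 2`; its second moment
suffices when `w` is larger, because `φ` is also dominated by a quadratic. Hence the probability is
at most the exponential plus the expected excess of `w / (C y) ^ 2` over one, which the layer-cake
formula turns into the tail integral.

No decoupling inequality is needed: for a fixed `δ`, drawing variable `j` from copy number `δ j`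
produces the same product law, and on the retained terms this is exactly the decoupled evaluation.
-/

namespace UStat

open scoped RealInnerProductSpace Nat

/-! ### A convex power function with linear growth, and its gradient. -/

section PowHuber

/-- The function `t ↦ t ^ p`, continued by its tangent line to the right of `x`. -/
noncomputable def powHuber (p : ℕ) (x t : ℝ) : ℝ :=
  min t x ^ p + p * x ^ (p - 1) * (t - min t x)

/-- Bernoulli's inequality at `s / t - 1`, scaled by `t ^ p`. -/
theorem pow_tangent_le (p : ℕ) {s t : ℝ} (hs : 0 ≤ s) (ht : 0 ≤ t) :
    t ^ p + p * t ^ (p - 1) * (s - t) ≤ s ^ p := by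
  rcases p with _ | p
  · simp
  rcases ht.eq_or_lt with rfl | ht
  · rcases p with _ | p
    · simp
    · simp; positivity
  have h := one_add_mul_le_pow (a := s / t - 1) (by have : 0 ≤ s / t := by positivity
                                                    linarith) (p + 1)
  have h2 := mul_le_mul_of_nonneg_left h (pow_nonneg ht.le (p + 1))
  rw [← mul_pow] at h2
  have e1 : t * (1 + (s / t - 1)) = s := by field_simp; ring
  rw [e1] at h2
  refine le_trans (le_of_eq ?_) h2
  simp only [Nat.add_sub_cancel]
  field_simp
  ring

theorem powHuber_tangent_le (p : ℕ) {x s t : ℝ} (hx : 0 ≤ x) (hs : 0 ≤ s) (ht : 0 ≤ t) :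
    powHuber p x t + p * min t x ^ (p - 1) * (s - t) ≤ powHuber p x s := by
  unfold powHuber
  have hpow : ∀ {t : ℝ}, 0 ≤ t → t ≤ x → (p : ℝ) * t ^ (p - 1) ≤ p * x ^ (p - 1) :=
    fun h0 h1 => by gcongr
  rcases le_total t x with h1 | h1 <;> rcases le_total s x with h2 | h2 <;>
    simp only [min_eq_left, min_eq_right, h1, h2, sub_self, mul_zero, add_zero]
  · exact pow_tangent_le p hs ht
  · have := pow_tangent_le p hx ht
    nlinarith [mul_le_mul_of_nonneg_right (hpow ht h1) (sub_nonneg.2 h2)]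
  · have := pow_tangent_le p hs hx
    nlinarith
  · nlinarith

theorem powHuber_nonneg (p : ℕ) {x t : ℝ} (hx : 0 ≤ x) (ht : 0 ≤ t) : 0 ≤ powHuber p x t := by
  have : 0 ≤ t - min t x := sub_nonneg.2 (min_le_left _ _)
  have : 0 ≤ min t x := le_min ht hx
  unfold powHuber
  positivity

theorem powHuber_le_pow (p : ℕ) {x t : ℝ} (hx : 0 ≤ x) (ht : 0 ≤ t) : powHuber p x t ≤ t ^ p := by
  unfold powHuber
  rcases le_total t x with h1 | h1 <;>
    simp only [min_eq_left, min_eq_right, h1, sub_self, mul_zero, add_zero]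
  · exact le_rfl
  · exact pow_tangent_le p ht hx

theorem powHuber_le_linear (p : ℕ) {x t : ℝ} (hx : 0 ≤ x) (ht : 0 ≤ t) :
    powHuber p x t ≤ x ^ p + p * x ^ (p - 1) * t := by
  unfold powHuber
  have h0 : 0 ≤ min t x := le_min ht hx
  have h1 : min t x ≤ x := min_le_right _ _
  gcongr
  linarith

/-- Beyond `x` the linear bound becomes quadratic through `t ≤ t ^ 2 / x`. This lets a second moment
alone control the part where the conditional variance is large. -/
theorem powHuber_le_quadratic {p : ℕ} (hp : p ≠ 0) {x t : ℝ} (hx : 0 < x) (ht : 0 ≤ t) :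
    powHuber p x t ≤ x ^ p * (1 + p * t ^ 2 / x ^ 2) := by
  rcases le_total t x with h1 | h1
  · unfold powHuber
    simp only [min_eq_left h1, sub_self, mul_zero, add_zero]
    calc t ^ p ≤ x ^ p * 1 := by rw [mul_one]; gcongr
      _ ≤ _ := by gcongr; simp only [le_add_iff_nonneg_right]; positivity
  · refine (powHuber_le_linear p hx.le ht).trans ?_
    obtain ⟨p, rfl⟩ := Nat.exists_eq_succ_of_ne_zero hp
    simp only [Nat.succ_eq_add_one, Nat.add_sub_cancel]
    have : t * x ≤ t ^ 2 := by nlinarith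
    have h2 : x ^ (p + 1) * (1 + ((p + 1 : ℕ) : ℝ) * t ^ 2 / x ^ 2) =
        x ^ (p + 1) + ((p + 1 : ℕ) : ℝ) * x ^ p * (t ^ 2 / x) := by
      field_simp
      ring
    rw [h2]
    gcongr
    rw [le_div_iff₀ hx]
    exact this

theorem pow_le_powHuber (p : ℕ) {x t : ℝ} (hx : 0 ≤ x) (hxt : x ≤ t) :
    x ^ p ≤ powHuber p x t := by
  unfold powHuber
  rw [min_eq_right hxt]
  have := sub_nonneg.2 hxt
  simp only [le_add_iff_nonneg_right]
  positivity

theorem continuous_powHuber (p : ℕ) (x : ℝ) : Continuous (powHuber p x) := by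
  unfold powHuber
  fun_prop

variable {H : Type*} [NormedAddCommGroup H] [InnerProductSpace ℝ H]

/-- The gradient of `u ↦ powHuber p x ‖u‖`. -/
noncomputable def powHuberGrad (p : ℕ) (x : ℝ) (u : H) : H :=
  (p * min ‖u‖ x ^ (p - 1) / ‖u‖) • u

/-- The scalar tangent inequality at `‖u‖` carries over to vectors by Cauchy–Schwarz, since the
slope is nonnegative. -/
theorem powHuber_subgradient_le (p : ℕ) {x : ℝ} (hx : 0 ≤ x) (u v : H) :
    powHuber p x ‖u‖ + ⟪powHuberGrad p x u, v - u⟫ ≤ powHuber p x ‖v‖ := by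
  refine le_trans ?_ (powHuber_tangent_le p hx (norm_nonneg v) (norm_nonneg u))
  gcongr
  rcases eq_or_ne u 0 with rfl | hu
  · simp only [powHuberGrad, smul_zero, inner_zero_left, norm_zero, sub_zero]
    have : 0 ≤ min 0 x := le_min le_rfl hx
    positivity
  have hu' : 0 < ‖u‖ := norm_pos_iff.2 hu
  have hm : 0 ≤ min ‖u‖ x := le_min hu'.le hx
  have hp : 0 ≤ p * min ‖u‖ x ^ (p - 1) := by positivity
  rw [powHuberGrad, real_inner_smul_left, inner_sub_right, real_inner_self_eq_norm_sq,
    div_mul_eq_mul_div, div_le_iff₀ hu', mul_assoc _ (‖v‖ - ‖u‖)]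
  refine mul_le_mul_of_nonneg_left ?_ hp
  nlinarith [real_inner_le_norm u v]

/-- Boundedness of the gradient makes its inner product with a merely integrable kernel integrable.
-/
theorem norm_powHuberGrad_le (p : ℕ) {x : ℝ} (hx : 0 ≤ x) (u : H) :
    ‖powHuberGrad p x u‖ ≤ p * x ^ (p - 1) := by
  have hm : 0 ≤ min ‖u‖ x := le_min (norm_nonneg u) hx
  rcases eq_or_ne u 0 with rfl | hu
  · simp only [powHuberGrad, smul_zero, norm_zero]; positivity
  have hu' : 0 < ‖u‖ := norm_pos_iff.2 hu
  rw [powHuberGrad, norm_smul, Real.norm_of_nonneg (by positivity), div_mul_cancel₀ _ hu'.ne']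
  gcongr
  exact min_le_right _ _

theorem measurable_powHuberGrad [MeasurableSpace H] [BorelSpace H] [SecondCountableTopology H]
    (p : ℕ) (x : ℝ) : Measurable (powHuberGrad p x : H → H) := by
  unfold powHuberGrad
  fun_prop

/-- Jensen's inequality for `v ↦ powHuber p x ‖v‖` and a finite average. -/
theorem card_mul_powHuber_norm_le_sum {ι : Type*} [Fintype ι] (p : ℕ) {x : ℝ} (hx : 0 ≤ x) (u : H)
    (v : ι → H) (huv : (Fintype.card ι : ℝ) • u = ∑ i, v i) :
    Fintype.card ι * powHuber p x ‖u‖ ≤ ∑ i, powHuber p x ‖v i‖ := by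
  have h := Finset.sum_le_sum fun i (_ : i ∈ Finset.univ) => powHuber_subgradient_le p hx u (v i)
  rw [Finset.sum_add_distrib, ← inner_sum, Finset.sum_sub_distrib, ← huv] at h
  simpa [← Nat.cast_smul_eq_nsmul ℝ] using h

end PowHuber

/-! ### Khintchine's inequality and moments of Rademacher chaos. -/

section Chaos

/-- The `2 * q`-th moment of a standard Gaussian random variable. -/
noncomputable def gaussMoment (q : ℕ) : ℝ := (2 * q)! / (2 ^ q * q !)

theorem gaussMoment_pos (q : ℕ) : 0 < gaussMoment q := by
  unfold gaussMoment; positivity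

@[simp] theorem gaussMoment_one : gaussMoment 1 = 1 := by norm_num [gaussMoment]

theorem gaussMoment_le (q : ℕ) : gaussMoment q ≤ (q : ℝ) ^ q := by
  unfold gaussMoment
  rw [div_le_iff₀ (by positivity)]
  have h : ((2 * q)! : ℝ) ≤ (2 * q : ℝ) ^ q * q ! := by
    exact_mod_cast Nat.factorial_two_mul_le q
  rw [mul_pow] at h
  linarith

/-- Multiplying the left side by `gaussMoment j` would give equality, and `gaussMoment j ≥ 1`. -/
theorem choose_mul_gaussMoment_le {q j : ℕ} (hj : j ≤ q) :
    ((2 * q).choose (2 * j) : ℝ) * gaussMoment (q - j) ≤ gaussMoment q * q.choose j := by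
  obtain ⟨d, rfl⟩ := Nat.exists_eq_add_of_le hj
  have h : ((2 ^ j * j ! : ℕ) : ℝ) ≤ (2 * j)! := by
    exact_mod_cast Nat.two_pow_mul_factorial_le_factorial_two_mul j
  rw [Nat.cast_choose ℝ (show 2 * j ≤ 2 * (j + d) by omega), Nat.cast_choose ℝ hj]
  have e1 : 2 * (j + d) - 2 * j = 2 * d := by omega
  have e2 : j + d - j = d := by omega
  rw [e1, e2]
  unfold gaussMoment
  have l1 : ((2 * (j + d))! : ℝ) / ((2 * j)! * (2 * d)!) * ((2 * d)! / (2 ^ d * d !)) =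
      (2 * (j + d))! / (2 ^ d * d ! * (2 * j)!) := by
    field_simp
  have l2 : ((2 * (j + d))! : ℝ) / (2 ^ (j + d) * (j + d)!) * ((j + d)! / (j ! * d !)) =
      (2 * (j + d))! / (2 ^ d * d ! * (2 ^ j * j ! : ℕ)) := by
    push_cast
    field_simp
    ring
  rw [l1, l2]
  have : (0 : ℝ) < (2 ^ j * j ! : ℕ) := by positivity
  gcongr

/-- The sign `±1` coded by a Boolean. -/
def rsign (b : Bool) : ℝ := if b then 1 else -1

@[simp] theorem rsign_true : rsign true = 1 := rfl
@[simp] theorem rsign_false : rsign false = -1 := rfl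

theorem sum_range_even (f : ℕ → ℝ) (q : ℕ) :
    ∑ k ∈ Finset.range (2 * q + 1), f k * (1 + (-1) ^ k) =
      2 * ∑ j ∈ Finset.range (q + 1), f (2 * j) := by
  induction q with
  | zero => simp; ring
  | succ q ih =>
    rw [show 2 * (q + 1) + 1 = 2 * q + 1 + 1 + 1 by ring, Finset.sum_range_succ,
      Finset.sum_range_succ, ih, Finset.sum_range_succ _ (q + 1)]
    have : (-1 : ℝ) ^ (2 * q + 1 + 1) = 1 := by
      rw [show 2 * q + 1 + 1 = 2 * (q + 1) by ring, pow_mul]; simp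
    have h2 : (-1 : ℝ) ^ (2 * q + 1) = -1 := by
      rw [pow_succ, pow_mul]; simp
    rw [this, h2, show 2 * q + 1 + 1 = 2 * (q + 1) by ring]
    ring

theorem add_pow_add_sub_pow (x y : ℝ) (q : ℕ) :
    (x + y) ^ (2 * q) + (x - y) ^ (2 * q) =
      2 * ∑ j ∈ Finset.range (q + 1),
        ((2 * q).choose (2 * j) : ℝ) * (x ^ 2) ^ (q - j) * (y ^ 2) ^ j := by
  have h := sum_range_even (fun k => ((2 * q).choose k : ℝ) * x ^ (2 * q - k) * y ^ k) q
  have h2 : ∀ j, ((2 * q).choose (2 * j) : ℝ) * (x ^ 2) ^ (q - j) * (y ^ 2) ^ j =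
      ((2 * q).choose (2 * j) : ℝ) * x ^ (2 * q - 2 * j) * y ^ (2 * j) := by
    intro j
    rw [← pow_mul, ← pow_mul, Nat.mul_sub]
  simp_rw [h2]
  rw [← h, add_comm x y, sub_eq_neg_add x y, add_pow, add_pow, ← Finset.sum_add_distrib]
  refine Finset.sum_congr rfl fun k _ => ?_
  rw [neg_pow y]
  ring

variable {H : Type*} [NormedAddCommGroup H] [InnerProductSpace ℝ H]

/-- For fixed norms the two squared norms are `a ± 2c` with `|c| ≤ ‖u‖ * ‖v‖`. By convexity of the
`q`-th power the symmetric sum is largest at the endpoints, the collinear case. -/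
theorem norm_add_pow_add_norm_sub_pow_le (u v : H) (q : ℕ) :
    ‖u + v‖ ^ (2 * q) + ‖u - v‖ ^ (2 * q) ≤
      (‖u‖ + ‖v‖) ^ (2 * q) + (‖u‖ - ‖v‖) ^ (2 * q) := by
  have e1 : ‖u + v‖ ^ 2 = ‖u‖ ^ 2 + ‖v‖ ^ 2 + 2 * ⟪u, v⟫ := by rw [norm_add_sq_real]; ring
  have e2 : ‖u - v‖ ^ 2 = ‖u‖ ^ 2 + ‖v‖ ^ 2 - 2 * ⟪u, v⟫ := by rw [norm_sub_sq_real]; ring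
  have e3 : (‖u‖ + ‖v‖) ^ 2 = ‖u‖ ^ 2 + ‖v‖ ^ 2 + 2 * (‖u‖ * ‖v‖) := by ring
  have e4 : (‖u‖ - ‖v‖) ^ 2 = ‖u‖ ^ 2 + ‖v‖ ^ 2 - 2 * (‖u‖ * ‖v‖) := by ring
  simp only [pow_mul, e1, e2, e3, e4]
  have hc := abs_le.1 (abs_real_inner_le_norm u v)
  have hb : 2 * (‖u‖ * ‖v‖) ≤ ‖u‖ ^ 2 + ‖v‖ ^ 2 := by nlinarith [sq_nonneg (‖u‖ - ‖v‖)]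
  generalize ‖u‖ ^ 2 + ‖v‖ ^ 2 = a at hb ⊢
  generalize ⟪u, v⟫ = c at hc ⊢
  have hd : 0 ≤ ‖u‖ * ‖v‖ := by positivity
  generalize ‖u‖ * ‖v‖ = d at hb hc hd ⊢
  rcases hd.eq_or_lt with rfl | hd
  · have : c = 0 := by linarith [hc.1, hc.2]
    simp [this]
  have hcv := convexOn_pow (𝕜 := ℝ) q
  have m1 : a + 2 * d ∈ Set.Ici (0 : ℝ) := by simp only [Set.mem_Ici]; linarith
  have m2 : a - 2 * d ∈ Set.Ici (0 : ℝ) := by simp only [Set.mem_Ici]; linarith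
  have hθ : 0 ≤ (d + c) / (2 * d) := div_nonneg (by linarith [hc.1]) (by linarith)
  have hθ' : 0 ≤ (d - c) / (2 * d) := div_nonneg (by linarith [hc.2]) (by linarith)
  have hs : (d + c) / (2 * d) + (d - c) / (2 * d) = 1 := by field_simp; ring
  have k1 := hcv.2 m1 m2 hθ hθ' hs
  have k2 := hcv.2 m2 m1 hθ hθ' hs
  simp only [smul_eq_mul] at k1 k2
  have r1 : (d + c) / (2 * d) * (a + 2 * d) + (d - c) / (2 * d) * (a - 2 * d) = a + 2 * c := by
    field_simp; ring
  have r2 : (d + c) / (2 * d) * (a - 2 * d) + (d - c) / (2 * d) * (a + 2 * d) = a - 2 * c := by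
    field_simp; ring
  rw [r1] at k1
  rw [r2] at k2
  have : (d - c) / (2 * d) = 1 - (d + c) / (2 * d) := by linarith
  rw [this] at k1 k2
  nlinarith

/-- Khintchine's inequality for even moments in a Hilbert space, with the Gaussian constant. -/
theorem sum_norm_rademacher_pow_le (n : ℕ) (b : Fin n → H) (q : ℕ) :
    ∑ ε : Fin n → Bool, ‖∑ j, rsign (ε j) • b j‖ ^ (2 * q) ≤
      2 ^ n * gaussMoment q * (∑ j, ‖b j‖ ^ 2) ^ q := by
  induction n generalizing q with
  | zero =>
    rcases q with _ | q
    · simp [gaussMoment]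
    · simp
  | succ n ih =>
    -- Summing over the first sign leaves only even powers of the remaining sum's norm, so induction
    -- applies to each; `choose_mul_gaussMoment_le` makes the bounds recombine binomially.
    rw [← (Fin.consEquiv fun _ => Bool).sum_comp, Fintype.sum_prod_type_right]
    simp only [Fin.consEquiv_apply, Fin.sum_univ_succ, Fin.cons_zero, Fin.cons_succ,
      Fintype.sum_bool, rsign_true, rsign_false, one_smul, neg_smul]
    set V := ∑ j : Fin n, ‖b j.succ‖ ^ 2 with hV
    set S : (Fin n → Bool) → H := fun ε => ∑ j, rsign (ε j) • b j.succ with hS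
    calc _ ≤ ∑ ε, ((‖S ε‖ + ‖b 0‖) ^ (2 * q) + (‖S ε‖ - ‖b 0‖) ^ (2 * q)) := by
          refine Finset.sum_le_sum fun ε _ => ?_
          refine le_trans (le_of_eq ?_) (norm_add_pow_add_norm_sub_pow_le (S ε) (b 0) q)
          rw [add_comm (b 0), neg_add_eq_sub]
      _ = 2 * ∑ j ∈ Finset.range (q + 1), ((2 * q).choose (2 * j) : ℝ) *
            (∑ ε, ‖S ε‖ ^ (2 * (q - j))) * (‖b 0‖ ^ 2) ^ j := by
          simp_rw [add_pow_add_sub_pow, ← Finset.mul_sum]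
          rw [Finset.sum_comm]
          simp_rw [Finset.mul_sum, Finset.sum_mul, Finset.mul_sum, pow_mul]
      _ ≤ 2 * ∑ j ∈ Finset.range (q + 1), ((2 * q).choose (2 * j) : ℝ) *
            (2 ^ n * gaussMoment (q - j) * V ^ (q - j)) * (‖b 0‖ ^ 2) ^ j := by
          gcongr with j _
          exact ih (fun j => b j.succ) (q - j)
      _ ≤ 2 * ∑ j ∈ Finset.range (q + 1), 2 ^ n * (gaussMoment q * q.choose j) *
            (V ^ (q - j) * (‖b 0‖ ^ 2) ^ j) := by
          refine mul_le_mul_of_nonneg_left (Finset.sum_le_sum fun j hj => ?_) (by norm_num)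
          have hVn : 0 ≤ V := by positivity
          have := choose_mul_gaussMoment_le (Finset.mem_range_succ_iff.1 hj)
          calc _ = 2 ^ n * (((2 * q).choose (2 * j) : ℝ) * gaussMoment (q - j)) *
                (V ^ (q - j) * (‖b 0‖ ^ 2) ^ j) := by ring
            _ ≤ _ := by gcongr
      _ = _ := by
          rw [add_pow, Finset.mul_sum, Finset.mul_sum]
          exact Finset.sum_congr rfl fun j _ => by ring

theorem sum_fin_succ_pi {M : Type*} [AddCommMonoid M] {m n : ℕ}
    (f : (Fin (m + 1) → Fin n) → M) :
    ∑ i, f i = ∑ j, ∑ i : Fin m → Fin n, f (Fin.cons j i) := by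
  rw [← (Fin.consEquiv fun _ => Fin n).sum_comp, Fintype.sum_prod_type]
  rfl

/-- Moments of a decoupled Hilbert space valued Rademacher chaos. -/
theorem sum_norm_chaos_pow_le {H : Type*} [NormedAddCommGroup H] [InnerProductSpace ℝ H]
    (n m : ℕ) (a : (Fin m → Fin n) → H) (q : ℕ) :
    ∑ ε : Fin m → Fin n → Bool, ‖∑ i, (∏ k, rsign (ε k (i k))) • a i‖ ^ (2 * q) ≤
      (2 ^ n) ^ m * gaussMoment q ^ m * (∑ i, ‖a i‖ ^ 2) ^ q := by
  induction m generalizing H with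
  | zero => simp [← pow_mul]
  | succ m ih =>
    rw [← (Fin.consEquiv fun _ => Fin n → Bool).sum_comp, Fintype.sum_prod_type_right]
    -- The first index is absorbed into the values: given the other signs, Khintchine in the first
    -- sign vector produces the squared norm of a chaos of order `m` in the `ℓ²` sum of `n` copies
    -- of `H`. This is why `H` varies in the induction.
    let A : (Fin m → Fin n) → PiLp 2 (fun _ : Fin n => H) :=
      fun i => WithLp.toLp 2 fun j => a (Fin.cons j i)
    have hA : ∑ i, ‖A i‖ ^ 2 = ∑ i, ‖a i‖ ^ 2 := by
      simp_rw [PiLp.norm_sq_eq_of_L2]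
      rw [Finset.sum_comm, sum_fin_succ_pi]
    have hIH := ih A
    rw [hA] at hIH
    calc _ = ∑ ε : Fin m → Fin n → Bool, ∑ ε₀ : Fin n → Bool,
          ‖∑ j, rsign (ε₀ j) • (∑ i : Fin m → Fin n, (∏ k, rsign (ε k (i k))) • A i) j‖
            ^ (2 * q) := by
          refine Finset.sum_congr rfl fun ε _ => Finset.sum_congr rfl fun ε₀ _ => ?_
          congr 2
          rw [sum_fin_succ_pi]
          refine Finset.sum_congr rfl fun j _ => ?_
          simp [Fin.prod_univ_succ, Fin.consEquiv, mul_smul, Finset.smul_sum, A]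
      _ ≤ ∑ ε : Fin m → Fin n → Bool, 2 ^ n * gaussMoment q *
            ‖∑ i : Fin m → Fin n, (∏ k, rsign (ε k (i k))) • A i‖ ^ (2 * q) := by
          refine Finset.sum_le_sum fun ε _ => ?_
          refine (sum_norm_rademacher_pow_le n _ q).trans (le_of_eq ?_)
          rw [pow_mul, PiLp.norm_sq_eq_of_L2]
      _ ≤ 2 ^ n * gaussMoment q *
            ((2 ^ n) ^ m * gaussMoment q ^ m * (∑ i, ‖a i‖ ^ 2) ^ q) := by
          rw [← Finset.mul_sum]
          have := gaussMoment_pos q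
          gcongr
      _ = _ := by ring

end Chaos

end UStat

namespace UStat

open scoped RealInnerProductSpace

/-! ### Product measures and canonical kernels. -/

section ProductSpace

variable {S : Type*} [MeasurableSpace S] {ι κ : Type*} [Fintype ι] [Fintype κ]

/-- Replacing one coordinate by an independent copy preserves a product measure. -/
theorem measurePreserving_update [DecidableEq ι] (μ : Measure S) [IsProbabilityMeasure μ] (j : ι) :
    MeasurePreserving (fun z : (ι → S) × S => Function.update z.1 j z.2)
      ((Measure.pi fun _ => μ).prod μ) (Measure.pi fun _ => μ) := by
  have hm : Measurable (fun z : (ι → S) × S => Function.update z.1 j z.2) := by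
    refine measurable_pi_iff.2 fun i => ?_
    rcases eq_or_ne i j with rfl | hij
    · simpa using measurable_snd
    · simpa [hij, Function.comp_def] using (measurable_pi_apply i).comp measurable_fst
  refine ⟨hm, (Measure.pi_eq fun A hA => ?_).symm⟩
  rw [Measure.map_apply hm (.univ_pi hA)]
  have : (fun z : (ι → S) × S => Function.update z.1 j z.2) ⁻¹' Set.univ.pi A =
      (Set.univ.pi (Function.update A j Set.univ)) ×ˢ A j := by
    ext ⟨s, t⟩
    simp only [Set.mem_preimage, Set.mem_univ_pi, Set.mem_prod]
    constructor
    · intro h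
      refine ⟨fun i => ?_, by simpa using h j⟩
      rcases eq_or_ne i j with rfl | hij
      · simp
      · simpa [hij] using h i
    · rintro ⟨h1, h2⟩ i
      rcases eq_or_ne i j with rfl | hij
      · simpa using h2
      · simpa [hij] using h1 i
  rw [this, Measure.prod_prod, Measure.pi_pi, ← Finset.mul_prod_erase _ _ (Finset.mem_univ j),
    ← Finset.mul_prod_erase (a := j) _ (fun i => μ (A i)) (Finset.mem_univ j)]
  simp only [Function.update_self, measure_univ, one_mul]
  rw [mul_comm]
  congr 1
  refine Finset.prod_congr rfl fun i hi => ?_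
  rw [Function.update_of_ne (Finset.ne_of_mem_erase hi)]

/-- Selecting distinct coordinates maps a product of copies of `μ` to such a product. -/
theorem measurePreserving_comp_injective (μ : Measure S) [IsProbabilityMeasure μ] {i : κ → ι}
    (hi : Function.Injective i) :
    MeasurePreserving (fun (s : ι → S) k => s (i k)) (Measure.pi fun _ => μ)
      (Measure.pi fun _ => μ) := by
  have h := (iIndepFun_pi (μ := fun _ : ι => μ) (X := fun _ s => s)
    fun _ => aemeasurable_id).precomp hi
  rw [iIndepFun_iff_map_fun_eq_pi_map fun k => (measurable_pi_apply _).aemeasurable] at h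
  refine ⟨measurable_pi_iff.2 fun k => measurable_pi_apply _, h.trans ?_⟩
  congr 1
  ext1 k
  exact (measurePreserving_eval (fun _ : ι => μ) (i k)).map_eq

theorem integral_eq_integral_integral_update [DecidableEq ι] {E : Type*} [NormedAddCommGroup E]
    [NormedSpace ℝ E] (μ : Measure S) [IsProbabilityMeasure μ] (j : ι) {F : (ι → S) → E}
    (hF : Integrable F (Measure.pi fun _ => μ)) :
    ∫ s, F s ∂(Measure.pi fun _ => μ) =
      ∫ s, ∫ t, F (Function.update s j t) ∂μ ∂(Measure.pi fun _ => μ) := by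
  have hmp := measurePreserving_update μ j
  rw [← integral_prod (fun z : (ι → S) × S => F (Function.update z.1 j z.2))
    (hmp.integrable_comp_of_integrable hF)]
  conv_lhs => rw [← hmp.map_eq]
  rw [integral_map hmp.measurable.aemeasurable (by rw [hmp.map_eq]; exact hF.1)]

variable {H : Type*} [NormedAddCommGroup H] [InnerProductSpace ℝ H] [MeasurableSpace H]

/-- A kernel whose integral with respect to each of its variables vanishes. -/
structure IsCanonical (μ : Measure S) {m : ℕ} (f : (Fin m → S) → H) : Prop where
  measurable : Measurable f
  integrable : Integrable f (Measure.pi fun _ => μ)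
  integral_update : ∀ k, ∀ᵐ s ∂(Measure.pi fun _ => μ), ∫ t, f (Function.update s k t) ∂μ = 0

variable {m : ℕ} {μ : Measure S} [IsProbabilityMeasure μ] {f : (Fin m → S) → H}

theorem IsCanonical.integrable_comp (hf : IsCanonical μ f) {i : Fin m → ι}
    (hi : Function.Injective i) :
    Integrable (fun s : ι → S => f fun k => s (i k)) (Measure.pi fun _ => μ) :=
  (measurePreserving_comp_injective μ hi).integrable_comp_of_integrable hf.integrable

variable [SecondCountableTopology H] [BorelSpace H]

theorem integrable_inner_of_norm_le {α : Type*} [MeasurableSpace α] {ν : Measure α}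
    {Z g : α → H} (hZ : Measurable Z) {c : ℝ} (hc : ∀ s, ‖Z s‖ ≤ c) (hg : Integrable g ν) :
    Integrable (fun s => ⟪Z s, g s⟫) ν := by
  refine (hg.norm.const_mul c).mono'
    (hZ.aestronglyMeasurable.inner hg.1) (.of_forall fun s => ?_)
  exact (norm_inner_le_norm _ _).trans (by gcongr; exact hc s)

/-- A degenerate term is orthogonal to everything that does not depend on one of its variables. -/
theorem IsCanonical.integral_inner_eq_zero [CompleteSpace H] [DecidableEq ι] (hf : IsCanonical μ f) {i : Fin m → ι}
    (hi : Function.Injective i) (k : Fin m) {Z : (ι → S) → H} (hZ : Measurable Z) {c : ℝ}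
    (hc : ∀ s, ‖Z s‖ ≤ c) (hZi : ∀ s t, Z (Function.update s (i k) t) = Z s) :
    ∫ s, ⟪Z s, f fun k => s (i k)⟫ ∂(Measure.pi fun _ => μ) = 0 := by
  have hint := hf.integrable_comp hi
  rw [integral_eq_integral_integral_update μ (i k) (integrable_inner_of_norm_le hZ hc hint)]
  refine integral_eq_zero_of_ae ?_
  have h1 := ((measurePreserving_update μ (i k)).integrable_comp_of_integrable hint).prod_right_ae
  have h2 := (measurePreserving_comp_injective μ hi).quasiMeasurePreserving.ae
    (hf.integral_update k)
  filter_upwards [h1, h2] with s hs1 hs2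
  have e : ∀ t, (fun l => Function.update s (i k) t (i l)) =
      Function.update (fun l => s (i l)) k t :=
    fun t => Function.update_comp_eq_of_injective s hi k t
  simp only [hZi]
  simp only [Function.comp_def] at hs1
  rw [integral_inner hs1]
  simp only [e, hs2, inner_zero_right, Pi.zero_apply]

end ProductSpace

/-! ### From random sequences to product measures. -/

section IID

variable {Ω S : Type*} [mΩ : MeasurableSpace Ω] [mS : MeasurableSpace S] {P : Measure Ω}
  {ξ : ℕ → Ω → S}

theorem IsIID.measurePreserving [IsProbabilityMeasure P] (hξ : IsIID ξ P) {ι : Type*} [Fintype ι] {σ : ι → ℕ}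
    (hσ : Function.Injective σ) :
    MeasurePreserving (fun ω k => ξ (σ k) ω) P (Measure.pi fun _ => P.map (ξ 0)) := by
  have h := hξ.2.1.precomp hσ
  rw [iIndepFun_iff_map_fun_eq_pi_map fun k => (hξ.1 _).aemeasurable] at h
  refine ⟨measurable_pi_iff.2 fun k => hξ.1 _, h.trans ?_⟩
  congr 1
  ext1 k
  exact (hξ.2.2 (σ k)).map_eq

variable {H : Type*} [NormedAddCommGroup H] [InnerProductSpace ℝ H] [CompleteSpace H]
  [SecondCountableTopology H] [MeasurableSpace H] [BorelSpace H]

/-- For independent coordinates, conditioning on all but one amounts to integrating that one out. -/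
theorem IsDegenerate.isCanonical [IsProbabilityMeasure P] (hξ : IsIID ξ P) {m : ℕ}
    {h : (Fin m → ℕ) → (Fin m → S) → H}
    (hm : ∀ i : Fin m → ℕ, StrictMono i → Measurable (h i)) (hd : IsDegenerate h ξ P)
    {i : Fin m → ℕ} (hi : StrictMono i) : IsCanonical (P.map (ξ 0)) (h i) := by
  set μ := P.map (ξ 0) with hμ
  have : IsProbabilityMeasure μ := Measure.isProbabilityMeasure_map (hξ.1 0).aemeasurable
  set f := h i with hf
  have hfm : Measurable f := hm i hi
  obtain ⟨hint, hcond⟩ := hd i hi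
  have hX : MeasurePreserving (fun ω (k : Fin m) => ξ k ω) P (Measure.pi fun _ => μ) :=
    hξ.measurePreserving Fin.val_injective
  have hintf : Integrable f (Measure.pi fun _ => μ) :=
    (hX.integrable_comp hfm.aestronglyMeasurable).1 hint
  refine ⟨hfm, hintf, fun j₀ => ?_⟩
  have hle : (⨆ j : {j : Fin m // j ≠ j₀}, mS.comap (ξ (j : Fin m))) ≤ mΩ := iSup_le fun j => (hξ.1 _).comap_le
  let R : Ω → {j : Fin m // j ≠ j₀} → S := fun ω j => ξ (j : Fin m) ω
  have hR : Measurable[(⨆ j : {j : Fin m // j ≠ j₀}, mS.comap (ξ (j : Fin m)))] R := by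
    refine @measurable_pi_lambda _ _ _ (⨆ j : {j : Fin m // j ≠ j₀}, mS.comap (ξ (j : Fin m))) _ _ fun j => ?_
    exact measurable_iff_comap_le.2
      (le_iSup (fun j : {j : Fin m // j ≠ j₀} => mS.comap (ξ (j : Fin m))) j)
  have hsup :
      (⨆ j : {j : Fin m // j ≠ j₀}, mS.comap (ξ (j : Fin m))) ≤ MeasurableSpace.comap R inferInstance := by
    refine iSup_le fun j => ?_
    have : ξ (j : Fin m) = (fun r : {j : Fin m // j ≠ j₀} → S => r j) ∘ R := rfl
    rw [this, ← MeasurableSpace.comap_comp]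
    exact MeasurableSpace.comap_mono (measurable_iff_comap_le.1 (measurable_pi_apply j))
  let ext : ({j : Fin m // j ≠ j₀} → S) → S → Fin m → S :=
    fun r t j => if hj : j = j₀ then t else r ⟨j, hj⟩
  have hext : ∀ (s : Fin m → S) t, Function.update s j₀ t = ext (fun j => s j) t := by
    intro s t
    ext1 j
    by_cases hj : j = j₀
    · subst hj; simp [ext]
    · simp [ext, hj]
  have hextm : Measurable (fun z : ({j : Fin m // j ≠ j₀} → S) × S => ext z.1 z.2) := by
    refine measurable_pi_iff.2 fun j => ?_
    by_cases hj : j = j₀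
    · simpa [ext, hj] using measurable_snd
    · simpa [ext, hj, Function.comp_def] using (measurable_pi_apply _).comp measurable_fst
  let G : (Fin m → S) → H := fun s => ∫ t, f (Function.update s j₀ t) ∂μ
  have hGm : StronglyMeasurable fun r => ∫ t, f (ext r t) ∂μ :=
    (show StronglyMeasurable (Function.uncurry fun r t => f (ext r t)) from
      (hfm.comp hextm).stronglyMeasurable).integral_prod_right
  have hGint : Integrable G (Measure.pi fun _ => μ) :=
    ((measurePreserving_update μ j₀).integrable_comp_of_integrable hintf).integral_prod_left
  have key : (fun ω => G fun k => ξ k ω) =ᵐ[P] 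
      P[fun ω => f fun k => ξ k ω | ⨆ j : {j : Fin m // j ≠ j₀}, mS.comap (ξ (j : Fin m))] := by
    refine ae_eq_condExp_of_forall_setIntegral_eq hle hint
      (fun E _ _ => (hX.integrable_comp_of_integrable hGint).integrableOn) (fun E hE _ => ?_) ?_
    · obtain ⟨E', hE', rfl⟩ := hsup _ hE
      let E₁ : Set (Fin m → S) := (fun s (j : {j : Fin m // j ≠ j₀}) => s j) ⁻¹' E'
      have hE₁ : MeasurableSet E₁ := (measurable_pi_iff.2 fun j => measurable_pi_apply _) hE'
      have hpre : R ⁻¹' E' = (fun ω (k : Fin m) => ξ k ω) ⁻¹' E₁ := rfl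
      -- A test event of the conditioning σ-algebra ignores coordinate `j₀`, so its indicator passes
      -- through the inner integral in Fubini's theorem.
      have hinv : ∀ s t, Function.update s j₀ t ∈ E₁ ↔ s ∈ E₁ := by
        intro s t
        have : (fun j : {j : Fin m // j ≠ j₀} => Function.update s j₀ t j) =
            fun j : {j : Fin m // j ≠ j₀} => s j := by
          ext1 j
          simp [j.2]
        simp only [E₁, Set.mem_preimage, this]
      rw [hpre, ← setIntegral_map hE₁ (by rw [hX.map_eq]; exact hGint.1) hX.measurable.aemeasurable,
        ← setIntegral_map hE₁ hfm.aestronglyMeasurable hX.measurable.aemeasurable, hX.map_eq,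
        ← integral_indicator hE₁, ← integral_indicator hE₁,
        integral_eq_integral_integral_update μ j₀ (hintf.indicator hE₁)]
      congr 1 with s
      by_cases hs : s ∈ E₁
      · simp [Set.indicator, hinv, hs, G]
      · simp [Set.indicator, hinv, hs]
    · have : (fun ω => G fun k => ξ k ω) = (fun r => ∫ t, f (ext r t) ∂μ) ∘ R := by
        ext1 ω
        simp only [G, hext, Function.comp, R]
      rw [this]
      exact (hGm.comp_measurable hR).aestronglyMeasurable
  have h0 : ∀ᵐ ω ∂P, G (fun k => ξ k ω) = 0 := by
    filter_upwards [key, hcond j₀] with ω h1 h2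
    rw [h1, h2]
    rfl
  rw [← hX.map_eq, ae_map_iff hX.measurable.aemeasurable]
  · exact h0
  · have : StronglyMeasurable G := by
      have hGe : G = (fun r => ∫ t, f (ext r t) ∂μ) ∘
          (fun s (j : {j : Fin m // j ≠ j₀}) => s j) := by
        ext1 s
        simp only [G, hext, Function.comp]
      rw [hGe]
      exact hGm.comp_measurable (measurable_pi_iff.2 fun j => measurable_pi_apply _)
    exact this.measurable (measurableSet_singleton 0)

/-- Selecting every coordinate from one of the independent copies gives an i.i.d. sequence. -/
theorem IsIndepCopies.measurePreserving {Ω' : Type*} [MeasurableSpace Ω'] {P' : Measure Ω'}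
    [IsProbabilityMeasure P] {m : ℕ} {ξdec : Fin m → ℕ → Ω' → S} (hξ : IsIID ξ P)
    (hdec : IsIndepCopies ξdec P' ξ P) {n : ℕ} (δ : Fin n → Fin m) :
    MeasurePreserving (fun ω j => ξdec (δ j) j ω) P' (Measure.pi fun _ => P.map (ξ 0)) := by
  have : IsProbabilityMeasure (P.map (ξ 0)) :=
    Measure.isProbabilityMeasure_map (hξ.1 0).aemeasurable
  have hmeas : Measurable (fun ω (j : Fin n) => ξdec (δ j) j ω) :=
    measurable_pi_iff.2 fun j => hdec.1 _ _
  refine ⟨hmeas, (Measure.pi_eq fun A hA => ?_).symm⟩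
  rw [Measure.map_apply hmeas (.univ_pi hA)]
  -- Coordinates are grouped by the copy they come from: independence of the copies splits the
  -- probability over `l`, and the i.i.d. property splits it within each group.
  let B : Fin m → Set (ℕ → S) := fun l => ⋂ j : {j : Fin n // δ j = l}, {s | s (j : Fin n) ∈ A j}
  have hB : ∀ l, MeasurableSet (B l) :=
    fun l => .iInter fun j => measurable_pi_apply _ (hA _)
  have e1 : (fun ω (j : Fin n) => ξdec (δ j) j ω) ⁻¹' Set.univ.pi A =
      ⋂ l ∈ (Finset.univ : Finset (Fin m)), (fun ω (i : ℕ) => ξdec l i ω) ⁻¹' B l := by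
    ext ω
    simp only [Set.mem_preimage, Set.mem_univ_pi, B, Set.mem_iInter, Finset.mem_univ,
      Set.mem_ofPred_eq, Subtype.forall, forall_const]
    exact ⟨fun h l a hl => hl ▸ h a, fun h a => h _ a rfl⟩
  rw [e1, hdec.2.1.measure_inter_preimage_eq_mul Finset.univ fun l _ => hB l,
    ← Finset.prod_fiberwise (s := Finset.univ) (g := δ)]
  refine Finset.prod_congr rfl fun l _ => ?_
  rw [(hdec.2.2 l).measure_mem_eq (hB l)]
  have hl := hξ.measurePreserving (σ := fun j : {j : Fin n // δ j = l} => ((j : Fin n) : ℕ))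
    (Fin.val_injective.comp Subtype.val_injective)
  have e2 : (fun ω (i : ℕ) => ξ i ω) ⁻¹' B l =
      (fun ω (j : {j : Fin n // δ j = l}) => ξ (j : Fin n) ω) ⁻¹'
        Set.univ.pi fun j => A j := by
    ext ω
    simp [B]
  rw [e2, hl.measure_preimage (MeasurableSet.univ_pi fun j => hA _).nullMeasurableSet,
    Measure.pi_pi, Finset.prod_subtype (p := fun j => δ j = l) (Finset.univ.filter fun j => δ j = l) (by simp)]

end IID

end UStat

namespace UStat

open scoped RealInnerProductSpace

/-! ### Convex moments under orthogonality. -/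

section Convexity

variable {H : Type*} [NormedAddCommGroup H] {α : Type*} [MeasurableSpace α] {ν : Measure α}
  [IsFiniteMeasure ν]

theorem integrable_powHuber_norm (p : ℕ) {x : ℝ} (hx : 0 ≤ x) {U : α → H} (hU : Integrable U ν) :
    Integrable (fun s => powHuber p x ‖U s‖) ν := by
  refine ((integrable_const (x ^ p)).add (hU.norm.const_mul (p * x ^ (p - 1)))).mono'
    ((continuous_powHuber p x).comp_aestronglyMeasurable hU.1.norm) (.of_forall fun s => ?_)
  rw [Real.norm_of_nonneg (powHuber_nonneg p hx (norm_nonneg _))]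
  exact powHuber_le_linear p hx (norm_nonneg _)

variable [InnerProductSpace ℝ H]

theorem powHuber_norm_add_le (p : ℕ) {x : ℝ} (hx : 0 ≤ x) (u v : H) :
    2 * powHuber p x ‖u + v‖ ≤
      powHuber p x ‖(2 : ℝ) • u‖ + powHuber p x ‖(2 : ℝ) • v‖ := by
  have := card_mul_powHuber_norm_le_sum p hx (u + v) ![(2 : ℝ) • u, (2 : ℝ) • v] (by simp)
  simpa using this

variable [MeasurableSpace H] [SecondCountableTopology H] [BorelSpace H]

/-- Adding a term that is orthogonal to the gradient does not decrease a convex moment. -/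
theorem integral_powHuber_norm_le_of_orthogonal (p : ℕ) {x : ℝ} (hx : 0 ≤ x) {A B : α → H} (hAm : Measurable A)
    (hA : Integrable A ν) (hB : Integrable B ν)
    (hAB : ∫ s, ⟪powHuberGrad p x (A s), B s⟫ ∂ν = 0) :
    ∫ s, powHuber p x ‖A s‖ ∂ν ≤ ∫ s, powHuber p x ‖A s + B s‖ ∂ν := by
  have hi : Integrable (fun s => ⟪powHuberGrad p x (A s), B s⟫) ν := integrable_inner_of_norm_le ((measurable_powHuberGrad p x).comp hAm)
    (fun s => norm_powHuberGrad_le p hx (A s)) hB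
  have hA' := integrable_powHuber_norm p hx hA
  calc _ = ∫ s, (powHuber p x ‖A s‖ + ⟪powHuberGrad p x (A s), B s⟫) ∂ν := by
        rw [integral_add hA' hi, hAB, add_zero]
    _ ≤ _ := by
        refine integral_mono (hA'.add hi) (integrable_powHuber_norm p hx (hA.add hB)) fun s => ?_
        simpa using powHuber_subgradient_le p hx (A s) (A s + B s)

/-- Symmetrization with a fixed choice of signs. -/
theorem integral_powHuber_norm_add_le (p : ℕ) {x : ℝ} (hx : 0 ≤ x) {A B : α → H} (hAm : Measurable A)
    (hBm : Measurable B) (hA : Integrable A ν) (hB : Integrable B ν)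
    (hAB : ∫ s, ⟪powHuberGrad p x ((2 : ℝ) • A s), B s⟫ ∂ν = 0)
    (hBA : ∫ s, ⟪powHuberGrad p x ((2 : ℝ) • B s), A s⟫ ∂ν = 0) :
    ∫ s, powHuber p x ‖A s + B s‖ ∂ν ≤ ∫ s, powHuber p x ‖(2 : ℝ) • (A s - B s)‖ ∂ν := by
  -- Convexity splits `A + B` into the average of `2A` and `2B`; orthogonality then allows
  -- subtracting `2B` from the former and `2A` from the latter.
  have h1 := integral_powHuber_norm_le_of_orthogonal p hx (hAm.const_smul (2 : ℝ))
    (hA.smul (2 : ℝ)) (hB.smul (-2 : ℝ)) (by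
      simp only [Pi.smul_apply, real_inner_smul_right, integral_const_mul, hAB, mul_zero])
  have h2 := integral_powHuber_norm_le_of_orthogonal p hx (hBm.const_smul (2 : ℝ))
    (hB.smul (2 : ℝ)) (hA.smul (-2 : ℝ)) (by
      simp only [Pi.smul_apply, real_inner_smul_right, integral_const_mul, hBA, mul_zero])
  simp only [Pi.smul_apply] at h1 h2
  have e1 : ∀ s, (2 : ℝ) • A s + (-2 : ℝ) • B s = (2 : ℝ) • (A s - B s) := fun s => by module
  have e2 : ∀ s, ‖(2 : ℝ) • B s + (-2 : ℝ) • A s‖ = ‖(2 : ℝ) • (A s - B s)‖ := fun s => by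
    rw [← norm_neg]; congr 1; module
  simp only [e1] at h1
  simp only [e2] at h2
  have i1 : Integrable (fun s => powHuber p x ‖(2 : ℝ) • A s‖) ν :=
    integrable_powHuber_norm p hx (hA.smul (2 : ℝ))
  have i2 : Integrable (fun s => powHuber p x ‖(2 : ℝ) • B s‖) ν :=
    integrable_powHuber_norm p hx (hB.smul (2 : ℝ))
  have h3 : ∫ s, 2 * powHuber p x ‖A s + B s‖ ∂ν ≤
      ∫ s, (powHuber p x ‖(2 : ℝ) • A s‖ + powHuber p x ‖(2 : ℝ) • B s‖) ∂ν :=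
    integral_mono ((integrable_powHuber_norm p hx (hA.add hB)).const_mul 2) (i1.add i2)
      fun s => powHuber_norm_add_le p hx (A s) (B s)
  rw [integral_const_mul, integral_add i1 i2] at h3
  linarith

end Convexity

/-- The map `δ` is prescribed at `m` distinct points and free elsewhere. The count does not depend
on `i`, so averaging over all `δ` weights every term by the same `m ^ (-m)`. -/
theorem card_filter_partition {m n : ℕ} {i : Fin m → Fin n} (hi : Function.Injective i) :
    (Finset.univ.filter fun δ : Fin n → Fin m => ∀ k, δ (i k) = k).card = m ^ (n - m) := by
  classical
  have h : (Finset.univ.filter fun δ : Fin n → Fin m => ∀ k, δ (i k) = k) =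
      Fintype.piFinset fun j => Finset.univ.filter fun l => ∀ k, i k = j → l = k := by
    ext δ
    simp only [Finset.mem_filter, Finset.mem_univ, true_and, Fintype.mem_piFinset]
    exact ⟨fun h j k hk => hk ▸ h k, fun h k => h _ k rfl⟩
  have hc : ∀ j, (Finset.univ.filter fun l : Fin m => ∀ k, i k = j → l = k).card =
      if j ∈ Finset.univ.image i then 1 else m := by
    intro j
    split_ifs with hj
    · obtain ⟨k, -, rfl⟩ := Finset.mem_image.1 hj
      rw [Finset.card_eq_one]
      refine ⟨k, ?_⟩
      ext l
      simp only [Finset.mem_filter, Finset.mem_univ, true_and, Finset.mem_singleton]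
      exact ⟨fun h => h k rfl, fun h k' hk' => h.trans (hi hk').symm⟩
    · rw [Finset.filter_true_of_mem, Finset.card_univ, Fintype.card_fin]
      intro l _ k hk
      exact absurd (Finset.mem_image.2 ⟨k, Finset.mem_univ _, hk⟩) hj
  rw [h, Fintype.card_piFinset]
  simp only [hc]
  rw [Finset.prod_ite, Finset.prod_const_one, one_mul, Finset.prod_const]
  congr 1
  rw [Finset.filter_not, Finset.card_sdiff_of_subset (Finset.filter_subset _ _)]
  simp [Finset.card_image_of_injective _ hi]

/-! ### Partitioning, symmetrization and Doob's inequality for kernel sums. -/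

section KernelSum

variable {S H : Type*} [NormedAddCommGroup H] [InnerProductSpace ℝ H] {m n : ℕ}

/-- A weighted sum of kernels, each evaluated at the coordinates selected by its index. -/
noncomputable def kernelSum (I : Finset (Fin m → Fin n)) (c : (Fin m → Fin n) → ℝ)
    (f : (Fin m → Fin n) → (Fin m → S) → H) (s : Fin n → S) : H :=
  ∑ i ∈ I, c i • f i fun k => s (i k)

variable {I : Finset (Fin m → Fin n)} {c : (Fin m → Fin n) → ℝ}
  {f : (Fin m → Fin n) → (Fin m → S) → H}

theorem kernelSum_update {j : Fin n} (hj : ∀ i ∈ I, ∀ k, i k ≠ j) (s : Fin n → S) (t : S) :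
    kernelSum I c f (Function.update s j t) = kernelSum I c f s := by
  refine Finset.sum_congr rfl fun i hi => ?_
  congr 2
  ext1 k
  rw [Function.update_of_ne (hj i hi k)]

theorem kernelSum_smul (a : ℝ) (s : Fin n → S) :
    kernelSum I (fun i => a * c i) f s = a • kernelSum I c f s := by
  simp only [kernelSum, mul_smul, Finset.smul_sum]

variable [MeasurableSpace S] {μ : Measure S} [MeasurableSpace H]

theorem integrable_kernelSum [IsProbabilityMeasure μ]
    (hf : ∀ i ∈ I, Function.Injective i ∧ IsCanonical μ (f i)) :
    Integrable (kernelSum I c f) (Measure.pi fun _ => μ) :=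
  integrable_finsetSum _ fun i hi => ((hf i hi).2.integrable_comp (hf i hi).1).smul (c i)

theorem measurable_kernelSum [SecondCountableTopology H] [BorelSpace H]
    (hf : ∀ i ∈ I, Function.Injective i ∧ IsCanonical μ (f i)) :
    Measurable (kernelSum I c f) :=
  Finset.measurable_fun_sum _ fun i hi =>
    ((hf i hi).2.measurable.comp (measurable_pi_iff.2 fun _ => measurable_pi_apply _)).const_smul
      (c i)

variable [IsProbabilityMeasure μ]

/-- Decoupling by a partition of the variables into `m` classes. -/
theorem exists_partition_integral_powHuber_le (hmn : m ≤ n) (hm : m ≠ 0) (p : ℕ) {x : ℝ}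
    (hx : 0 ≤ x) (hf : ∀ i ∈ I, Function.Injective i ∧ IsCanonical μ (f i)) :
    ∃ δ : Fin n → Fin m,
      ∫ s, powHuber p x ‖kernelSum I c f s‖ ∂(Measure.pi fun _ => μ) ≤
        ∫ s, powHuber p x ‖kernelSum (I.filter fun i => ∀ k, δ (i k) = k)
          (fun i => (m : ℝ) ^ m * c i) f s‖ ∂(Measure.pi fun _ => μ) := by
  have : NeZero m := ⟨hm⟩
  have hf' : ∀ (q : (Fin m → Fin n) → Prop) [DecidablePred q], ∀ i ∈ I.filter q,
      Function.Injective i ∧ IsCanonical μ (f i) :=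
    fun q _ i hi => hf i (Finset.mem_filter.1 hi).1
  have hpt : ∀ s, (Fintype.card (Fin n → Fin m) : ℝ) * powHuber p x ‖kernelSum I c f s‖ ≤
      ∑ δ : Fin n → Fin m, powHuber p x ‖kernelSum (I.filter fun i => ∀ k, δ (i k) = k)
        (fun i => (m : ℝ) ^ m * c i) f s‖ := by
    intro s
    refine card_mul_powHuber_norm_le_sum p hx _ _ ?_
    simp only [kernelSum, Finset.sum_filter]
    rw [Finset.sum_comm, Finset.smul_sum]
    refine Finset.sum_congr rfl fun i hi => ?_
    rw [← Finset.sum_filter, Finset.sum_const, card_filter_partition (hf i hi).1,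
      ← Nat.cast_smul_eq_nsmul ℝ, smul_smul, smul_smul]
    congr 1
    simp only [Fintype.card_fun, Fintype.card_fin, Nat.cast_pow]
    rw [← mul_assoc, ← pow_add, Nat.sub_add_cancel hmn]
  have hint : ∀ δ : Fin n → Fin m, Integrable (fun s => powHuber p x
      ‖kernelSum (I.filter fun i => ∀ k, δ (i k) = k) (fun i => (m : ℝ) ^ m * c i) f s‖)
      (Measure.pi fun _ => μ) :=
    fun δ => integrable_powHuber_norm p hx (integrable_kernelSum (hf' _))
  have h := integral_mono ((integrable_powHuber_norm p hx
    (integrable_kernelSum (c := c) hf)).const_mul _) (integrable_finsetSum _ fun δ _ => hint δ) hpt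
  rw [integral_const_mul, integral_finsetSum _ fun δ _ => hint δ, ← nsmul_eq_mul,
    ← Finset.card_univ, ← Finset.sum_const] at h
  obtain ⟨δ, -, hδ⟩ := Finset.exists_le_of_sum_le Finset.univ_nonempty h
  exact ⟨δ, hδ⟩

variable [SecondCountableTopology H] [BorelSpace H] [CompleteSpace H]

theorem integral_inner_kernelSum_eq_zero
    (hf : ∀ i ∈ I, Function.Injective i ∧ IsCanonical μ (f i)) {Z : (Fin n → S) → H}
    (hZ : Measurable Z) {b : ℝ} (hb : ∀ s, ‖Z s‖ ≤ b)
    (hZi : ∀ i ∈ I, ∃ k, ∀ s t, Z (Function.update s (i k) t) = Z s) :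
    ∫ s, ⟪Z s, kernelSum I c f s⟫ ∂(Measure.pi fun _ => μ) = 0 := by
  simp only [kernelSum, inner_sum, real_inner_smul_right]
  rw [integral_finsetSum]
  · refine Finset.sum_eq_zero fun i hi => ?_
    obtain ⟨k, hk⟩ := hZi i hi
    rw [integral_const_mul, (hf i hi).2.integral_inner_eq_zero (hf i hi).1 k hZ hb hk, mul_zero]
  · intro i hi
    exact (integrable_inner_of_norm_le hZ hb
      ((hf i hi).2.integrable_comp (hf i hi).1)).const_mul _

/-- If the variables are partitioned into classes and each term uses exactly one variable of each
class, arbitrary signs may be attached to the variables of one class. -/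
theorem integral_powHuber_kernelSum_le_sign (p : ℕ) {x : ℝ} (hx : 0 ≤ x)
    (hf : ∀ i ∈ I, Function.Injective i ∧ IsCanonical μ (f i)) {δ : Fin n → Fin m}
    (hδ : ∀ i ∈ I, ∀ k, δ (i k) = k) (c : (Fin m → Fin n) → ℝ) (k : Fin m) (e : Fin n → Bool) :
    ∫ s, powHuber p x ‖kernelSum I c f s‖ ∂(Measure.pi fun _ => μ) ≤
      ∫ s, powHuber p x ‖kernelSum I (fun i => 2 * rsign (e (i k)) * c i) f s‖
        ∂(Measure.pi fun _ => μ) := by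
  set It := I.filter fun i => e (i k) = true with hIt
  set If := I.filter fun i => ¬ e (i k) = true with hIf
  have hft : ∀ i ∈ It, Function.Injective i ∧ IsCanonical μ (f i) :=
    fun i hi => hf i (Finset.mem_filter.1 hi).1
  have hff : ∀ i ∈ If, Function.Injective i ∧ IsCanonical μ (f i) :=
    fun i hi => hf i (Finset.mem_filter.1 hi).1
  -- The class `k` variable of a term of one sign occurs in no term of the other sign: in another
  -- slot its class would be wrong, in slot `k` its sign. This yields both orthogonality relations.
  have hne : ∀ i ∈ It, ∀ i' ∈ If, ∀ l, i l ≠ i' k ∧ i' l ≠ i k := by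
    intro i hi i' hi' l
    obtain ⟨hi, hit⟩ := Finset.mem_filter.1 hi
    obtain ⟨hi', hif⟩ := Finset.mem_filter.1 hi'
    constructor
    · intro h
      have hl : l = k := by rw [← hδ i hi l, h, hδ i' hi' k]
      subst hl
      exact hif (h ▸ hit)
    · intro h
      have hl : l = k := by rw [← hδ i' hi' l, h, hδ i hi k]
      subst hl
      exact hif (h ▸ hit)
  have key := integral_powHuber_norm_add_le (ν := Measure.pi fun _ : Fin n => μ) p hx
    (measurable_kernelSum (c := c) hft) (measurable_kernelSum (c := c) hff)
    (integrable_kernelSum hft) (integrable_kernelSum hff)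
    (integral_inner_kernelSum_eq_zero hff
      ((measurable_powHuberGrad p x).comp ((measurable_kernelSum hft).const_smul (2 : ℝ)))
      (fun s => norm_powHuberGrad_le p hx _) fun i' hi' => ⟨k, fun s t => by
        rw [kernelSum_update fun i hi l => (hne i hi i' hi' l).1]⟩)
    (integral_inner_kernelSum_eq_zero hft
      ((measurable_powHuberGrad p x).comp ((measurable_kernelSum hff).const_smul (2 : ℝ)))
      (fun s => norm_powHuberGrad_le p hx _) fun i hi => ⟨k, fun s t => by
        rw [kernelSum_update fun i' hi' l => (hne i hi i' hi' l).2]⟩)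
  have e1 : ∀ s, kernelSum It c f s + kernelSum If c f s = kernelSum I c f s :=
    fun s => Finset.sum_filter_add_sum_filter_not I _ _
  have e2 : ∀ s, (2 : ℝ) • (kernelSum It c f s - kernelSum If c f s) =
      kernelSum I (fun i => 2 * rsign (e (i k)) * c i) f s := by
    intro s
    have h1 : kernelSum I (fun i => 2 * rsign (e (i k)) * c i) f s =
        kernelSum It (fun i => 2 * rsign (e (i k)) * c i) f s +
          kernelSum If (fun i => 2 * rsign (e (i k)) * c i) f s :=
      (Finset.sum_filter_add_sum_filter_not I _ _).symm
    have h2 : kernelSum It (fun i => 2 * rsign (e (i k)) * c i) f s =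
        (2 : ℝ) • kernelSum It c f s := by
      rw [← kernelSum_smul]
      refine Finset.sum_congr rfl fun i hi => ?_
      simp [(Finset.mem_filter.1 hi).2]
    have h3 : kernelSum If (fun i => 2 * rsign (e (i k)) * c i) f s =
        (-2 : ℝ) • kernelSum If c f s := by
      rw [← kernelSum_smul]
      refine Finset.sum_congr rfl fun i hi => ?_
      simp [Bool.eq_false_of_not_eq_true (Finset.mem_filter.1 hi).2]
    rw [h1, h2, h3]
    module
  simpa only [e1, e2] using key

theorem integral_powHuber_kernelSum_le_signs (p : ℕ) {x : ℝ} (hx : 0 ≤ x)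
    (hf : ∀ i ∈ I, Function.Injective i ∧ IsCanonical μ (f i)) {δ : Fin n → Fin m}
    (hδ : ∀ i ∈ I, ∀ k, δ (i k) = k) (c : (Fin m → Fin n) → ℝ) (ε : Fin m → Fin n → Bool) :
    ∫ s, powHuber p x ‖kernelSum I c f s‖ ∂(Measure.pi fun _ => μ) ≤
      ∫ s, powHuber p x ‖kernelSum I (fun i => (∏ k, 2 * rsign (ε k (i k))) * c i) f s‖
        ∂(Measure.pi fun _ => μ) := by
  induction (Finset.univ : Finset (Fin m)) using Finset.induction_on with
  | empty => simp
  | insert k T hk ih =>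
    refine (ih.trans (integral_powHuber_kernelSum_le_sign p hx hf hδ _ k (ε k))).trans_eq ?_
    simp only [Finset.prod_insert hk, mul_assoc]

/-- Doob's maximal inequality for the partial sums of a degenerate statistic. -/
theorem pow_mul_measureReal_exists_lt_norm_le (p : ℕ) {x : ℝ} (hx : 0 ≤ x)
    (hf : ∀ i ∈ I, Function.Injective i ∧ IsCanonical μ (f i)) :
    x ^ p * (Measure.pi fun _ : Fin n => μ).real
      {s | ∃ r ∈ Finset.range (n + 1),
        x < ‖kernelSum (I.filter fun i => ∀ k, (i k : ℕ) < r) c f s‖} ≤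
      ∫ s, powHuber p x ‖kernelSum I c f s‖ ∂(Measure.pi fun _ => μ) := by
  set ν := Measure.pi fun _ : Fin n => μ with hν
  set U : ℕ → (Fin n → S) → H := fun r => kernelSum (I.filter fun i => ∀ k, (i k : ℕ) < r) c f
    with hU
  set W : ℕ → (Fin n → S) → H := fun r => kernelSum (I.filter fun i => ¬ ∀ k, (i k : ℕ) < r) c f
    with hW
  have hf' : ∀ (q : (Fin m → Fin n) → Prop) [DecidablePred q], ∀ i ∈ I.filter q,
      Function.Injective i ∧ IsCanonical μ (f i) :=
    fun q _ i hi => hf i (Finset.mem_filter.1 hi).1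
  have hUm : ∀ r, Measurable (U r) := fun r => measurable_kernelSum (hf' _)
  have hUW : ∀ r s, kernelSum I c f s - U r s = W r s := by
    intro r s
    rw [sub_eq_iff_eq_add']
    exact (Finset.sum_filter_add_sum_filter_not I _ _).symm
  -- First passage above `x` at time `r`, where `U r` uses the variables `0, …, r - 1`. Each term of
  -- the remainder `W r` has a variable of index at least `r`, on which the gradient at `U r`
  -- restricted to `E r` does not depend.
  set E : ℕ → Set (Fin n → S) := fun r => {s | x < ‖U r s‖ ∧ ∀ r' < r, ‖U r' s‖ ≤ x} with hE
  have hEm : ∀ r, MeasurableSet (E r) := by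
    intro r
    refine (measurableSet_lt measurable_const (hUm r).norm).inter ?_
    have : {s | ∀ r' < r, ‖U r' s‖ ≤ x} = ⋂ r', ⋂ (_ : r' < r), {s | ‖U r' s‖ ≤ x} := by
      ext s; simp
    change MeasurableSet {s | ∀ r' < r, ‖U r' s‖ ≤ x}
    rw [this]
    exact .iInter fun r' => .iInter fun _ => measurableSet_le (hUm r').norm measurable_const
  set Z : ℕ → (Fin n → S) → H := fun r => (E r).indicator fun s => powHuberGrad p x (U r s)
    with hZ
  have hZm : ∀ r, Measurable (Z r) := fun r =>
    ((measurable_powHuberGrad p x).comp (hUm r)).indicator (hEm r)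
  have hZb : ∀ r s, ‖Z r s‖ ≤ p * x ^ (p - 1) := fun r s =>
    (norm_indicator_le_norm_self _ _).trans (norm_powHuberGrad_le p hx _)
  have hUi : ∀ (r : ℕ) (j : Fin n), r ≤ j → ∀ s t, U r (Function.update s j t) = U r s := by
    intro r j hj s t
    refine kernelSum_update (fun i hi k => ?_) s t
    rintro rfl
    exact absurd ((Finset.mem_filter.1 hi).2 k) (by omega)
  have hZi : ∀ (r : ℕ) (j : Fin n), r ≤ j → ∀ s t, Z r (Function.update s j t) = Z r s := by
    intro r j hj s t
    have hEi : Function.update s j t ∈ E r ↔ s ∈ E r := by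
      simp only [hE, Set.mem_ofPred_eq, hUi r j hj]
      refine and_congr_right fun _ => forall₂_congr fun r' hr' => ?_
      rw [hUi r' j (by omega)]
    by_cases hs : s ∈ E r
    · simp only [hZ, Set.indicator_of_mem hs, Set.indicator_of_mem (hEi.2 hs), hUi r j hj]
    · simp only [hZ, Set.indicator_of_notMem hs, Set.indicator_of_notMem (mt hEi.1 hs)]
  have hZ0 : ∀ r, ∫ s, ⟪Z r s, W r s⟫ ∂ν = 0 := by
    intro r
    refine integral_inner_kernelSum_eq_zero (hf' _) (hZm r) (hZb r) fun i hi => ?_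
    have h := (Finset.mem_filter.1 hi).2
    push Not at h
    obtain ⟨k, hk⟩ := h
    exact ⟨k, hZi r _ hk⟩
  have hZint : ∀ r, Integrable (fun s => ⟪Z r s, W r s⟫) ν := fun r =>
    integrable_inner_of_norm_le (hZm r) (hZb r) (integrable_kernelSum (hf' _))
  set F : Set (Fin n → S) := {s | ∃ r ∈ Finset.range (n + 1), x < ‖U r s‖} with hF
  have hFm : MeasurableSet F := by
    have : F = ⋃ r ∈ Finset.range (n + 1), {s | x < ‖U r s‖} := by
      ext s; simp [hF]
    rw [this]
    exact Finset.measurableSet_biUnion _ fun r _ =>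
      measurableSet_lt measurable_const (hUm r).norm
  have hpt : ∀ s, F.indicator (fun _ => x ^ p) s +
      ∑ r ∈ Finset.range (n + 1), ⟪Z r s, W r s⟫ ≤ powHuber p x ‖kernelSum I c f s‖ := by
    intro s
    by_cases hs : s ∈ F
    · obtain ⟨r, hr, hrE⟩ : ∃ r ∈ Finset.range (n + 1), s ∈ E r := by
        classical
        have hex : ∃ r, x < ‖U r s‖ := by obtain ⟨r, _, h⟩ := hs; exact ⟨r, h⟩
        refine ⟨Nat.find hex, ?_, Nat.find_spec hex, fun r' hr' => not_lt.1 (Nat.find_min hex hr')⟩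
        obtain ⟨r, hr, h⟩ := hs
        have := Nat.find_min' hex h
        simp only [Finset.mem_range] at hr ⊢
        omega
      rw [Finset.sum_eq_single_of_mem r hr fun r' _ hne => ?_]
      · rw [Set.indicator_of_mem hs, ← hUW]
        simp only [hZ, Set.indicator_of_mem hrE]
        refine le_trans ?_ (powHuber_subgradient_le p hx (U r s) _)
        gcongr
        exact pow_le_powHuber p hx hrE.1.le
      · have : s ∉ E r' := by
          intro h'
          rcases lt_or_gt_of_ne hne with h | h
          · exact absurd h'.1 (not_lt.2 (hrE.2 r' h))
          · exact absurd hrE.1 (not_lt.2 (h'.2 r h))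
        simp only [hZ, Set.indicator_of_notMem this, inner_zero_left]
    · rw [Finset.sum_eq_zero fun r hr => ?_, Set.indicator_of_notMem hs, add_zero]
      · exact powHuber_nonneg p hx (norm_nonneg _)
      · have : s ∉ E r := fun h => hs ⟨r, hr, h.1⟩
        simp only [hZ, Set.indicator_of_notMem this, inner_zero_left]
  have hFint : Integrable (F.indicator fun _ => x ^ p) ν := (integrable_const _).indicator hFm
  have hSint := integrable_finsetSum (Finset.range (n + 1)) fun r _ => hZint r
  have h := integral_mono (hFint.add hSint)
    (integrable_powHuber_norm p hx (integrable_kernelSum (c := c) hf)) hpt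
  have e0 : ∫ s, ∑ r ∈ Finset.range (n + 1), ⟪Z r s, W r s⟫ ∂ν = 0 := by
    rw [integral_finsetSum _ fun r _ => hZint r, Finset.sum_eq_zero fun r _ => hZ0 r]
  have e1 := integral_add hFint hSint
  rw [e0, add_zero, integral_indicator_const _ hFm, smul_eq_mul, mul_comm] at e1
  exact e1.symm.le.trans h

end KernelSum

end UStat

namespace UStat

open scoped RealInnerProductSpace

/-! ### The two bounds after averaging over the signs. -/

section ConditionalMoments

variable {H : Type*} [NormedAddCommGroup H] [InnerProductSpace ℝ H] {m n : ℕ}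

theorem sum_powHuber_norm_chaos_le_pow (a : (Fin m → Fin n) → H) (q : ℕ) (K : ℝ) {x : ℝ}
    (hx : 0 ≤ x) :
    ∑ ε : Fin m → Fin n → Bool,
        powHuber (2 * q) x ‖K • ∑ i, (∏ k, rsign (ε k (i k))) • a i‖ ≤
      (2 ^ n) ^ m * ((K ^ 2) ^ q * gaussMoment q ^ m * (∑ i, ‖a i‖ ^ 2) ^ q) := by
  calc _ ≤ ∑ ε : Fin m → Fin n → Bool,
        (K ^ 2) ^ q * ‖∑ i, (∏ k, rsign (ε k (i k))) • a i‖ ^ (2 * q) := by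
        refine Finset.sum_le_sum fun ε _ => (powHuber_le_pow _ hx (norm_nonneg _)).trans_eq ?_
        rw [norm_smul, mul_pow, pow_mul ‖K‖, Real.norm_eq_abs, sq_abs]
    _ ≤ (K ^ 2) ^ q * ((2 ^ n) ^ m * gaussMoment q ^ m * (∑ i, ‖a i‖ ^ 2) ^ q) := by
        rw [← Finset.mul_sum]
        gcongr
        exact sum_norm_chaos_pow_le n m a q
    _ = _ := by ring

theorem sum_powHuber_norm_chaos_le_sq (a : (Fin m → Fin n) → H) {q : ℕ} (hq : q ≠ 0) (K : ℝ)
    {x : ℝ} (hx : 0 < x) :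
    ∑ ε : Fin m → Fin n → Bool,
        powHuber (2 * q) x ‖K • ∑ i, (∏ k, rsign (ε k (i k))) • a i‖ ≤
      (2 ^ n) ^ m * (x ^ (2 * q) * (1 + 2 * q * K ^ 2 * (∑ i, ‖a i‖ ^ 2) / x ^ 2)) := by
  have h := sum_norm_chaos_pow_le n m a 1
  simp only [mul_one, gaussMoment_one, one_pow, pow_one] at h
  calc _ ≤ ∑ ε : Fin m → Fin n → Bool, (x ^ (2 * q) + x ^ (2 * q) * (2 * q * K ^ 2 / x ^ 2) *
        ‖∑ i, (∏ k, rsign (ε k (i k))) • a i‖ ^ 2) := by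
        refine Finset.sum_le_sum fun ε _ =>
          (powHuber_le_quadratic (by omega) hx (norm_nonneg _)).trans_eq ?_
        rw [norm_smul, mul_pow, Real.norm_eq_abs, sq_abs]
        push_cast
        ring
    _ ≤ (2 ^ n) ^ m * x ^ (2 * q) + x ^ (2 * q) * (2 * q * K ^ 2 / x ^ 2) *
          ((2 ^ n) ^ m * ∑ i, ‖a i‖ ^ 2) := by
        rw [Finset.sum_add_distrib, ← Finset.mul_sum]
        gcongr
        simp [← pow_mul, mul_comm]
    _ = _ := by ring

end ConditionalMoments

/-! ### Choice of the exponent and of the scale. -/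

section Constants

/-- The constant lost by partitioning and symmetrizing. -/
noncomputable def lossConst (m : ℕ) : ℝ := 2 ^ m * (m : ℝ) ^ m

theorem lossConst_pos {m : ℕ} (hm : 1 ≤ m) : 0 < lossConst m := by
  have : (0 : ℝ) < m := by exact_mod_cast hm
  unfold lossConst
  positivity

/-- The scaling constant inside the probability on the right-hand side. -/
noncomputable def scaleConst (m : ℕ) : ℝ :=
  √(Real.exp (-1) / (2 ^ (m + 2) * lossConst m ^ 2))

theorem scaleConst_pos {m : ℕ} (hm : 1 ≤ m) : 0 < scaleConst m := by
  have := lossConst_pos hm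
  unfold scaleConst
  positivity

theorem four_mul_lossConst_sq_mul_scaleConst_sq {m : ℕ} (hm : 1 ≤ m) :
    4 * lossConst m ^ 2 * scaleConst m ^ 2 * 2 ^ m = Real.exp (-1) := by
  have := lossConst_pos hm
  rw [scaleConst, Real.sq_sqrt (by positivity), pow_add]
  field_simp
  norm_num

/-- With the optimal exponent, a quantity satisfying both moment bounds is controlled by an
exponential term and the square of the conditional norm above the truncation level. -/
theorem le_exp_add_of_moment_bounds {m : ℕ} (hm : 1 ≤ m) {x y w A : ℝ} (hy : 0 < y) (hyx : y ≤ x)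
    (hw : 0 ≤ w) {q : ℕ} (hq : q = ⌈(x / y) ^ (2 / (m : ℝ))⌉₊)
    (h1 : A ≤ (lossConst m ^ 2) ^ q * gaussMoment q ^ m * w ^ q)
    (h2 : A ≤ x ^ (2 * q) * (1 + 2 * q * lossConst m ^ 2 * w / x ^ 2)) :
    A ≤ x ^ (2 * q) * (Real.exp (-(x / y) ^ (2 / (m : ℝ))) +
      max (w / (scaleConst m * y) ^ 2 - 1) 0) := by
  have hx : 0 < x := hy.trans_le hyx
  have hm0 : (0 : ℝ) < m := by exact_mod_cast hm
  have hxy : 1 ≤ x / y := (one_le_div hy).2 hyx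
  have hK := lossConst_pos hm
  have hC := scaleConst_pos hm
  have hKC := four_mul_lossConst_sq_mul_scaleConst_sq hm
  set r := (x / y) ^ (2 / (m : ℝ)) with hr
  have hr1 : 1 ≤ r := Real.one_le_rpow hxy (by positivity)
  have hrm : r ^ m = (x / y) ^ 2 := by
    rw [hr, ← Real.rpow_natCast, ← Real.rpow_mul (by positivity), div_mul_cancel₀ _ hm0.ne']
    norm_cast
  have hrq : r ≤ q := hq ▸ Nat.le_ceil r
  have hqr : (q : ℝ) ≤ 2 * r := by
    have := Nat.ceil_lt_add_one (zero_le_one.trans hr1)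
    rw [← hq] at this
    linarith
  have hr2 : r ≤ (x / y) ^ 2 := hrm ▸ le_self_pow₀ hr1 (by omega)
  set K := lossConst m
  set C := scaleConst m
  -- Below the threshold, `q ≤ 2r` and `r ^ m = (x / y) ^ 2` make the base of the `q`-th power at
  -- most `x ^ 2 * exp (-1)`. Above it, with `z = w / (C y) ^ 2`, the quadratic bound gives `1 + z /
  -- 2`, which is at most `z - 1` once `z ≥ 4`; hence the factor `4`.
  rcases le_or_gt w (4 * (C * y) ^ 2) with hwC | hwC
  · have hb : K ^ 2 * (q : ℝ) ^ m * w ≤ x ^ 2 * Real.exp (-1) := by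
      calc K ^ 2 * (q : ℝ) ^ m * w ≤ K ^ 2 * (2 * r) ^ m * (4 * (C * y) ^ 2) := by gcongr
        _ = (4 * K ^ 2 * C ^ 2 * 2 ^ m) * (r ^ m * y ^ 2) := by ring
        _ = x ^ 2 * Real.exp (-1) := by
            rw [hKC, hrm]
            field_simp
    calc A ≤ (K ^ 2) ^ q * gaussMoment q ^ m * w ^ q := h1
      _ ≤ (K ^ 2) ^ q * ((q : ℝ) ^ q) ^ m * w ^ q := by
          have := (gaussMoment_pos q).le
          gcongr
          exact gaussMoment_le q
      _ = (K ^ 2 * (q : ℝ) ^ m * w) ^ q := by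
          rw [mul_pow, mul_pow, ← pow_mul, ← pow_mul, mul_comm q m, ← pow_mul]
      _ ≤ (x ^ 2 * Real.exp (-1)) ^ q := by gcongr
      _ = x ^ (2 * q) * Real.exp (-q) := by
          rw [mul_pow, ← pow_mul, ← Real.exp_nat_mul]
          simp
      _ ≤ x ^ (2 * q) * (Real.exp (-r) + 0) := by rw [add_zero]; gcongr
      _ ≤ _ := by gcongr; exact le_max_right _ _
  · refine h2.trans (mul_le_mul_of_nonneg_left ?_ (by positivity))
    have hz : 4 < w / (C * y) ^ 2 := (lt_div_iff₀ (by positivity)).2 hwC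
    have hb : 2 * q * K ^ 2 * w / x ^ 2 ≤ (4 * K ^ 2 * C ^ 2) * (w / (C * y) ^ 2) := by
      have hq2 : (q : ℝ) ≤ 2 * (x / y) ^ 2 := by linarith
      calc 2 * q * K ^ 2 * w / x ^ 2 ≤ 2 * (2 * (x / y) ^ 2) * K ^ 2 * w / x ^ 2 := by gcongr
        _ = _ := by field_simp; ring
    have h2m : (2 : ℝ) ≤ 2 ^ m := by
      simpa using pow_le_pow_right₀ (one_le_two : (1 : ℝ) ≤ 2) hm
    have hKC2 : 4 * K ^ 2 * C ^ 2 ≤ 1 / 2 := by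
      have he : Real.exp (-1) ≤ 1 := Real.exp_le_one_iff.2 (by norm_num)
      have : 0 ≤ 4 * K ^ 2 * C ^ 2 := by positivity
      nlinarith
    have := mul_le_mul_of_nonneg_right hKC2 (zero_le_four.trans hz.le)
    have := le_max_left (w / (C * y) ^ 2 - 1) 0
    have := Real.exp_pos (-r)
    linarith

end Constants

/-! ### Layer-cake formula and averaging over signs. -/

section Assembly

theorem sum_Inc {M : Type*} [AddCommMonoid M] {m n N : ℕ} (hn : n ≤ N) (g : (Fin m → ℕ) → M) :
    ∑ i ∈ Inc m n, g i =
      ∑ i ∈ (Finset.univ.filter fun i : Fin m → Fin N => StrictMono i).filter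
        (fun i => ∀ k, (i k : ℕ) < n), g fun k => i k := by
  symm
  refine Finset.sum_bij (fun i _ k => (i k : ℕ)) ?_ ?_ ?_ fun _ _ => rfl
  · intro i hi
    simp only [Finset.mem_filter, Finset.mem_univ, true_and] at hi
    simp only [Inc, Finset.mem_filter, Fintype.mem_piFinset, Finset.mem_range]
    exact ⟨hi.2, fun a b hab => hi.1 hab⟩
  · intro i _ i' _ h
    ext1 k
    exact Fin.ext (congrFun h k)
  · intro i hi
    simp only [Inc, Finset.mem_filter, Fintype.mem_piFinset, Finset.mem_range] at hi
    refine ⟨fun k => ⟨i k, (hi.1 k).trans_le hn⟩, ?_, rfl⟩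
    simp only [Finset.mem_filter, Finset.mem_univ, true_and]
    exact ⟨fun a b hab => hi.2 hab, hi.1⟩

/-- The integral of the square above a level as an integral of tail probabilities. -/
theorem lintegral_sq_sub_one_le {Ω : Type*} [MeasurableSpace Ω] {P : Measure Ω} [SFinite P]
    {V : Ω → ℝ} (hV : Measurable V) (hV0 : ∀ ω, 0 ≤ V ω) {a : ℝ} (ha : 0 < a) :
    ∫⁻ ω, ENNReal.ofReal (max (V ω ^ 2 / a ^ 2 - 1) 0) ∂P ≤
      2 * ∫⁻ u in Set.Ioi (1 : ℝ), ENNReal.ofReal u * P {ω | a * u < V ω} := by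
  -- For `v > a` the excess is twice the integral of `u` over `(1, v / a)`; Tonelli's theorem then
  -- gives the tail integral.
  have hpt : ∀ v : ℝ, 0 ≤ v → ENNReal.ofReal (max (v ^ 2 / a ^ 2 - 1) 0) ≤
      2 * ∫⁻ u in Set.Ioi (1 : ℝ), ENNReal.ofReal u * {u | a * u < v}.indicator 1 u := by
    intro v hv
    rcases le_or_gt v a with hva | hva
    · have : v ^ 2 / a ^ 2 - 1 ≤ 0 := by
        rw [sub_nonpos, div_le_one (by positivity)]
        gcongr
      simp [max_eq_right this]
    · have h1 : 1 ≤ v / a := (one_le_div ha).2 hva.le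
      have hset : ∀ u ∈ Set.Ioo (1 : ℝ) (v / a),
          ENNReal.ofReal u * {u | a * u < v}.indicator 1 u = ENNReal.ofReal u := by
        intro u hu
        have : a * u < v := by
          have := (lt_div_iff₀ ha).1 hu.2
          linarith
        rw [Set.indicator_of_mem (show u ∈ {u | a * u < v} from this)]
        simp
      calc ENNReal.ofReal (max (v ^ 2 / a ^ 2 - 1) 0)
          = 2 * ENNReal.ofReal (∫ u in Set.Ioo (1 : ℝ) (v / a), u) := by
            rw [← integral_Ioc_eq_integral_Ioo, ← intervalIntegral.integral_of_le h1, integral_id,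
              ← ENNReal.ofReal_ofNat 2, ← ENNReal.ofReal_mul (by norm_num), max_eq_left]
            · congr 1; ring
            · rw [sub_nonneg, ← div_pow]
              exact one_le_pow₀ h1
        _ = 2 * ∫⁻ u in Set.Ioo (1 : ℝ) (v / a), ENNReal.ofReal u := by
            rw [ofReal_integral_eq_lintegral_ofReal]
            · exact (continuous_id.integrableOn_Icc (a := (1 : ℝ)) (b := v / a)).mono_set
                Set.Ioo_subset_Icc_self
            · filter_upwards [ae_restrict_mem measurableSet_Ioo] with u hu
              exact zero_le_one.trans hu.1.le
        _ = 2 * ∫⁻ u in Set.Ioo (1 : ℝ) (v / a),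
              ENNReal.ofReal u * {u | a * u < v}.indicator 1 u := by
            rw [setLIntegral_congr_fun measurableSet_Ioo hset]
        _ ≤ _ := by
            gcongr
            exact Set.Ioo_subset_Ioi_self
  have hms : MeasurableSet {z : Ω × ℝ | a * z.2 < V z.1} :=
    measurableSet_lt (measurable_snd.const_mul a) (hV.comp measurable_fst)
  have hjoint : Measurable fun z : Ω × ℝ =>
      ENNReal.ofReal z.2 * {u | a * u < V z.1}.indicator (1 : ℝ → ENNReal) z.2 :=
    measurable_snd.ennreal_ofReal.mul
      ((measurable_one : Measurable (1 : Ω × ℝ → ENNReal)).indicator hms)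
  calc _ ≤ ∫⁻ ω, 2 * (∫⁻ u in Set.Ioi (1 : ℝ),
        ENNReal.ofReal u * {u | a * u < V ω}.indicator 1 u) ∂P :=
        lintegral_mono fun ω => hpt (V ω) (hV0 ω)
    _ = 2 * ∫⁻ u in Set.Ioi (1 : ℝ), ∫⁻ ω,
        ENNReal.ofReal u * {u | a * u < V ω}.indicator 1 u ∂P := by
        rw [lintegral_const_mul' _ _ (by simp), lintegral_lintegral_swap hjoint.aemeasurable]
    _ = _ := by
        congr 1
        refine lintegral_congr fun u => ?_
        rw [lintegral_const_mul' _ _ (by simp)]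
        congr 1
        exact lintegral_indicator_one (measurableSet_lt measurable_const hV)

variable {S : Type*} [MeasurableSpace S] {H : Type*} [NormedAddCommGroup H]
  [InnerProductSpace ℝ H] [CompleteSpace H] [SecondCountableTopology H] [MeasurableSpace H]
  [BorelSpace H] {m n : ℕ} {I : Finset (Fin m → Fin n)}
  {f : (Fin m → Fin n) → (Fin m → S) → H} {μ : Measure S} [IsProbabilityMeasure μ]

/-- The sign bound holds for every choice of signs, hence for their average, and the conditional
chaos bounds apply pointwise in `s`. A lower integral is used on the right because the squared
kernels need not be integrable. -/
theorem ofReal_integral_powHuber_div_le (hm : 1 ≤ m)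
    (hf : ∀ i ∈ I, Function.Injective i ∧ IsCanonical μ (f i)) {δ : Fin n → Fin m}
    (hδ : ∀ i ∈ I, ∀ k, δ (i k) = k) {x y : ℝ} (hy : 0 < y) (hyx : y ≤ x) {q : ℕ}
    (hq : q = ⌈(x / y) ^ (2 / (m : ℝ))⌉₊) :
    ENNReal.ofReal ((∫ s, powHuber (2 * q) x ‖kernelSum I (fun _ => (m : ℝ) ^ m) f s‖
        ∂(Measure.pi fun _ => μ)) / x ^ (2 * q)) ≤
      ∫⁻ s, ENNReal.ofReal (Real.exp (-(x / y) ^ (2 / (m : ℝ))) +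
        max ((∑ i ∈ I, ‖f i fun k => s (i k)‖ ^ 2) / (scaleConst m * y) ^ 2 - 1) 0)
        ∂(Measure.pi fun _ => μ) := by
  have hx : 0 < x := hy.trans_le hyx
  have hq0 : q ≠ 0 := by
    have : 0 < (x / y) ^ (2 / (m : ℝ)) := by positivity
    have := Nat.ceil_pos.2 this
    omega
  let Φ : (Fin m → Fin n → Bool) → (Fin n → S) → ℝ := fun ε s => powHuber (2 * q) x
    ‖kernelSum I (fun i => (∏ k, 2 * rsign (ε k (i k))) * (m : ℝ) ^ m) f s‖
  have hΦi : ∀ ε, Integrable (Φ ε) (Measure.pi fun _ => μ) :=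
    fun ε => integrable_powHuber_norm _ hx.le (integrable_kernelSum hf)
  have hcard : (Fintype.card (Fin m → Fin n → Bool) : ℝ) = (2 ^ n) ^ m := by simp
  have hle : (2 ^ n : ℝ) ^ m * ∫ s, powHuber (2 * q) x
      ‖kernelSum I (fun _ => (m : ℝ) ^ m) f s‖ ∂(Measure.pi fun _ => μ) ≤
      ∫ s, ∑ ε, Φ ε s ∂(Measure.pi fun _ => μ) := by
    rw [integral_finsetSum _ fun ε _ => hΦi ε, ← hcard, ← nsmul_eq_mul, ← Finset.card_univ,
      ← Finset.sum_const]
    exact Finset.sum_le_sum fun ε _ => integral_powHuber_kernelSum_le_signs _ hx.le hf hδ _ ε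
  have hpt : ∀ s, (∑ ε, Φ ε s) / ((2 ^ n : ℝ) ^ m * x ^ (2 * q)) ≤
      Real.exp (-(x / y) ^ (2 / (m : ℝ))) +
        max ((∑ i ∈ I, ‖f i fun k => s (i k)‖ ^ 2) / (scaleConst m * y) ^ 2 - 1) 0 := by
    intro s
    let a : (Fin m → Fin n) → H := fun i => if i ∈ I then f i fun k => s (i k) else 0
    have ha : ∑ i, ‖a i‖ ^ 2 = ∑ i ∈ I, ‖f i fun k => s (i k)‖ ^ 2 := by
      simp [a, apply_ite (fun v : H => ‖v‖ ^ 2), Finset.sum_ite_mem]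
    have hΦa : ∀ ε, Φ ε s = powHuber (2 * q) x
        ‖lossConst m • ∑ i, (∏ k, rsign (ε k (i k))) • a i‖ := by
      intro ε
      simp only [Φ, kernelSum, a, smul_ite, smul_zero, Finset.sum_ite_mem, Finset.univ_inter]
      congr 2
      rw [Finset.smul_sum]
      refine Finset.sum_congr rfl fun i _ => ?_
      rw [smul_smul, Finset.prod_mul_distrib, lossConst]
      congr 1
      simp
      ring
    have h1 := sum_powHuber_norm_chaos_le_pow a q (lossConst m) hx.le
    have h2 := sum_powHuber_norm_chaos_le_sq a hq0 (lossConst m) hx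
    rw [ha] at h1 h2
    simp only [← hΦa] at h1 h2
    have hpos : (0 : ℝ) < (2 ^ n) ^ m := by positivity
    have h3 := le_exp_add_of_moment_bounds hm hy hyx
      (Finset.sum_nonneg fun i _ => by positivity) hq
      ((div_le_iff₀' hpos).2 h1) ((div_le_iff₀' hpos).2 h2)
    rw [← div_div, div_le_iff₀' (by positivity)]
    exact h3
  calc _ ≤ ENNReal.ofReal (∫ s, (∑ ε, Φ ε s) / ((2 ^ n : ℝ) ^ m * x ^ (2 * q))
        ∂(Measure.pi fun _ => μ)) := by
        refine ENNReal.ofReal_le_ofReal ?_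
        rw [integral_div, ← div_div]
        refine div_le_div_of_nonneg_right ?_ (by positivity)
        rwa [le_div_iff₀' (by positivity)]
    _ = ∫⁻ s, ENNReal.ofReal ((∑ ε, Φ ε s) / ((2 ^ n : ℝ) ^ m * x ^ (2 * q)))
        ∂(Measure.pi fun _ => μ) := by
        refine ofReal_integral_eq_lintegral_ofReal
          ((integrable_finsetSum _ fun ε _ => hΦi ε).div_const _) (.of_forall fun s => ?_)
        exact div_nonneg (Finset.sum_nonneg fun ε _ => powHuber_nonneg _ hx.le (norm_nonneg _))
          (by positivity)
    _ ≤ _ := lintegral_mono fun s => ENNReal.ofReal_le_ofReal (hpt s)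

end Assembly

end UStat

namespace UStat

theorem decNorm_sq {Ω' S H : Type*} [NormedAddCommGroup H] {m : ℕ}
    (h : (Fin m → ℕ) → (Fin m → S) → H) (ξdec : Fin m → ℕ → Ω' → S) (N : ℕ) (ω : Ω') :
    decNorm h ξdec N ω ^ 2 =
      ∑ i ∈ Finset.univ.filter fun i : Fin m → Fin N => StrictMono i,
        ‖h (fun k => i k) fun k => ξdec k (i k) ω‖ ^ 2 := by
  rw [decNorm, Real.sq_sqrt (Finset.sum_nonneg fun _ _ => by positivity), sum_Inc le_rfl,
    Finset.filter_true_of_mem fun i _ k => (i k).2]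

theorem measurable_decNorm {Ω' S H : Type*} [MeasurableSpace Ω'] [MeasurableSpace S]
    [NormedAddCommGroup H] [MeasurableSpace H] [OpensMeasurableSpace H] {m : ℕ}
    {h : (Fin m → ℕ) → (Fin m → S) → H} {ξdec : Fin m → ℕ → Ω' → S}
    (hm : ∀ i : Fin m → ℕ, StrictMono i → Measurable (h i)) (hξ : ∀ l i, Measurable (ξdec l i))
    (N : ℕ) : Measurable (decNorm h ξdec N) := by
  refine Measurable.sqrt (Finset.measurable_fun_sum _ fun i hi => ?_)
  exact (((hm i (Finset.mem_filter.1 hi).2).comp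
    (measurable_pi_iff.2 fun k => hξ k (i k))).norm).pow_const 2

/-! ### The maximal inequality with the decoupled square function. -/

section MaximalInequality

variable {H : Type*} [NormedAddCommGroup H] [InnerProductSpace ℝ H] [CompleteSpace H]
  [SecondCountableTopology H] [MeasurableSpace H] [BorelSpace H]
  {S Ω Ω' : Type*} [MeasurableSpace S] [MeasurableSpace Ω] {P : Measure Ω}
  [IsProbabilityMeasure P] [MeasurableSpace Ω'] {P' : Measure Ω'} {m : ℕ} {ξ : ℕ → Ω → S}
  {ξdec : Fin m → ℕ → Ω' → S} {h : (Fin m → ℕ) → (Fin m → S) → H}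

theorem measure_lt_sup_norm_uStat_le (hm : 1 ≤ m) (hξ : IsIID ξ P)
    (hdec : IsIndepCopies ξdec P' ξ P)
    (hmeas : ∀ i : Fin m → ℕ, StrictMono i → Measurable (h i)) (hd : IsDegenerate h ξ P)
    {N : ℕ} (hN : m ≤ N) {x y : ℝ} (hy : 0 < y) (hyx : y ≤ x) :
    P {ω | x < (Finset.Icc m N).sup' (Finset.nonempty_Icc.mpr hN) fun n => ‖uStat h ξ n ω‖} ≤
      ∫⁻ ω, ENNReal.ofReal (Real.exp (-(x / y) ^ (2 / (m : ℝ))) +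
        max (decNorm h ξdec N ω ^ 2 / (scaleConst m * y) ^ 2 - 1) 0) ∂P' := by
  have hx : 0 < x := hy.trans_le hyx
  set μ := P.map (ξ 0) with hμ
  have : IsProbabilityMeasure μ := Measure.isProbabilityMeasure_map (hξ.1 0).aemeasurable
  set I : Finset (Fin m → Fin N) := Finset.univ.filter fun i => StrictMono i with hI
  set f : (Fin m → Fin N) → (Fin m → S) → H := fun i => h fun k => i k with hf_def
  have hmono : ∀ i ∈ I, StrictMono fun k => (i k : ℕ) :=
    fun i hi a b hab => (Finset.mem_filter.1 hi).2 hab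
  have hf : ∀ i ∈ I, Function.Injective i ∧ IsCanonical μ (f i) := fun i hi =>
    ⟨(Finset.mem_filter.1 hi).2.injective, hd.isCanonical hξ hmeas (hmono i hi)⟩
  obtain ⟨q, hq⟩ : ∃ q, q = ⌈(x / y) ^ (2 / (m : ℝ))⌉₊ := ⟨_, rfl⟩
  have hX : MeasurePreserving (fun ω (j : Fin N) => ξ j ω) P (Measure.pi fun _ => μ) :=
    hξ.measurePreserving Fin.val_injective
  set F : Set (Fin N → S) := {s | ∃ r ∈ Finset.range (N + 1),
    x < ‖kernelSum (I.filter fun i => ∀ k, (i k : ℕ) < r) (fun _ => 1) f s‖} with hF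
  have hsub : {ω | x < (Finset.Icc m N).sup' (Finset.nonempty_Icc.mpr hN)
      fun n => ‖uStat h ξ n ω‖} ⊆ (fun ω (j : Fin N) => ξ j ω) ⁻¹' F := by
    intro ω hω
    rw [Set.mem_ofPred_eq, Finset.lt_sup'_iff] at hω
    obtain ⟨r, hr, hxr⟩ := hω
    have hrN := (Finset.mem_Icc.1 hr).2
    refine ⟨r, Finset.mem_range.2 (by omega), hxr.trans_eq ?_⟩
    congr 1
    rw [uStat, sum_Inc hrN]
    simp only [kernelSum, one_smul, hf_def, hI]
  obtain ⟨δ, hδ⟩ := exists_partition_integral_powHuber_le (c := fun _ => 1) hN (by omega)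
    (2 * q) hx.le hf
  simp only [mul_one] at hδ
  set J := I.filter fun i => ∀ k, δ (i k) = k with hJ
  have hJf : ∀ i ∈ J, Function.Injective i ∧ IsCanonical μ (f i) :=
    fun i hi => hf i (Finset.mem_filter.1 hi).1
  -- The product-space point is realized by the copies selected by `δ`. For `i ∈ J`, `δ (i k) = k`
  -- turns this into the decoupled argument, and the sum over `J` is part of `decNorm ^ 2`.
  have hY := hdec.measurePreserving hξ δ
  calc _ ≤ P ((fun ω (j : Fin N) => ξ j ω) ⁻¹' F) := measure_mono hsub
    _ ≤ (Measure.pi fun _ => μ) F := by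
        rw [← hX.map_eq]
        exact Measure.le_map_apply hX.measurable.aemeasurable F
    _ = ENNReal.ofReal ((Measure.pi fun _ : Fin N => μ).real F) := by simp
    _ ≤ ENNReal.ofReal ((∫ s, powHuber (2 * q) x ‖kernelSum J (fun _ => (m : ℝ) ^ m) f s‖
          ∂(Measure.pi fun _ => μ)) / x ^ (2 * q)) := by
        refine ENNReal.ofReal_le_ofReal ?_
        rw [le_div_iff₀' (by positivity)]
        exact (pow_mul_measureReal_exists_lt_norm_le (2 * q) hx.le hf).trans hδ
    _ ≤ ∫⁻ s, ENNReal.ofReal (Real.exp (-(x / y) ^ (2 / (m : ℝ))) +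
          max ((∑ i ∈ J, ‖f i fun k => s (i k)‖ ^ 2) / (scaleConst m * y) ^ 2 - 1) 0)
          ∂(Measure.pi fun _ => μ) :=
        ofReal_integral_powHuber_div_le hm hJf (fun i hi => (Finset.mem_filter.1 hi).2) hy hyx hq
    _ = ∫⁻ ω, ENNReal.ofReal (Real.exp (-(x / y) ^ (2 / (m : ℝ))) +
          max ((∑ i ∈ J, ‖f i fun k => ξdec (δ (i k)) (i k) ω‖ ^ 2) /
            (scaleConst m * y) ^ 2 - 1) 0) ∂P' := by
        refine (hY.lintegral_comp ?_).symm
        have : Measurable fun s : Fin N → S => ∑ i ∈ J, ‖f i fun k => s (i k)‖ ^ 2 :=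
          Finset.measurable_fun_sum _ fun i hi => (((hJf i hi).2.measurable.comp
            (measurable_pi_iff.2 fun _ => measurable_pi_apply _)).norm).pow_const 2
        fun_prop
    _ ≤ _ := by
        refine lintegral_mono fun ω => ENNReal.ofReal_le_ofReal ?_
        have hle : ∑ i ∈ J, ‖f i fun k => ξdec (δ (i k)) (i k) ω‖ ^ 2 ≤
            decNorm h ξdec N ω ^ 2 := by
          rw [decNorm_sq]
          calc _ = ∑ i ∈ J, ‖f i fun k => ξdec k (i k) ω‖ ^ 2 := by
                refine Finset.sum_congr rfl fun i hi => ?_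
                simp only [(Finset.mem_filter.1 hi).2]
            _ ≤ _ := Finset.sum_le_sum_of_subset_of_nonneg (Finset.filter_subset _ _)
                fun _ _ _ => by positivity
        gcongr

end MaximalInequality

end UStat

theorem mainTheorem1 (m : ℕ) (hm : 1 ≤ m) :
    ∃ A B C : ℝ, 0 < A ∧ 0 < B ∧ 0 < C ∧
      ∀ (H : Type*) [NormedAddCommGroup H] [InnerProductSpace ℝ H] [CompleteSpace H]
        [TopologicalSpace.SeparableSpace H] [MeasurableSpace H] [BorelSpace H]
        (S : Type*) [MeasurableSpace S]
        (Ω : Type*) [MeasurableSpace Ω] (P : Measure Ω) [IsProbabilityMeasure P]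
        (Ω' : Type*) [MeasurableSpace Ω'] (P' : Measure Ω') [IsProbabilityMeasure P']
        (ξ : ℕ → Ω → S) (ξdec : Fin m → ℕ → Ω' → S)
        (h : (Fin m → ℕ) → (Fin m → S) → H),
        UStat.IsIID ξ P →
        UStat.IsIndepCopies ξdec P' ξ P →
        (∀ i : Fin m → ℕ, StrictMono i → Measurable (h i)) →
        UStat.IsDegenerate h ξ P →
        ∀ (N : ℕ) (hN : m ≤ N) (x y : ℝ), 0 < x → 0 < y →
          P {ω | x < (Finset.Icc m N).sup' (Finset.nonempty_Icc.mpr hN)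
              (fun n => ‖UStat.uStat h ξ n ω‖)} ≤
            ENNReal.ofReal (A * Real.exp (-(x / y) ^ (2 / (m : ℝ)))) +
            ENNReal.ofReal B *
              ∫⁻ u in Set.Ioi (1 : ℝ),
                ENNReal.ofReal (u * (1 + Real.log u) ^ ((m : ℝ) * ((m : ℝ) + 1) / 2 - 1)) *
                P' {ω | C * y * u < UStat.decNorm h ξdec N ω} := by
  -- The `3` exceeds `e`, making the case `x < y` trivial; the `2` comes from the layer-cake
  -- formula.
  refine ⟨3, 2, UStat.scaleConst m, by norm_num, by norm_num, UStat.scaleConst_pos hm, ?_⟩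
  intro H _ _ _ _ _ _ S _ Ω _ P _ Ω' _ P' _ ξ ξdec h hξ hdec hmeas hd N hN x y hx hy
  have : SecondCountableTopology H := UniformSpace.secondCountable_of_separable H
  have hm1 : (1 : ℝ) ≤ m := by exact_mod_cast hm
  rcases lt_or_ge x y with hxy | hyx
  · refine prob_le_one.trans (le_add_right ?_)
    rw [← ENNReal.ofReal_one]
    refine ENNReal.ofReal_le_ofReal ?_
    have h1 : (x / y) ^ (2 / (m : ℝ)) ≤ 1 :=
      Real.rpow_le_one (by positivity) ((div_le_one hy).2 hxy.le) (by positivity)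
    have h2 : Real.exp (-1) ≤ Real.exp (-(x / y) ^ (2 / (m : ℝ))) := by gcongr
    have h3 : 1 ≤ 3 * Real.exp (-1) := by
      rw [Real.exp_neg, ← div_eq_mul_inv, one_le_div (Real.exp_pos 1)]
      linarith [Real.exp_one_lt_d9]
    linarith
  have hCy : 0 < UStat.scaleConst m * y := mul_pos (UStat.scaleConst_pos hm) hy
  refine (UStat.measure_lt_sup_norm_uStat_le hm hξ hdec hmeas hd hN hy hyx).trans ?_
  simp only [ENNReal.ofReal_add (Real.exp_pos _).le (le_max_right _ _)]
  rw [lintegral_add_left measurable_const, lintegral_const, measure_univ, mul_one]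
  gcongr
  · exact le_mul_of_one_le_left (Real.exp_pos _).le (by norm_num)
  · refine (UStat.lintegral_sq_sub_one_le (UStat.measurable_decNorm hmeas hdec.1 N)
      (fun ω => Real.sqrt_nonneg _) hCy).trans ?_
    rw [ENNReal.ofReal_ofNat]
    refine mul_le_mul_right (setLIntegral_mono' measurableSet_Ioi fun u hu => ?_) _
    have hu1 : 1 < u := hu
    gcongr
    -- The argument yields the tail integral without the logarithm; for `m ≥ 1` the exponent is
    -- nonnegative, so the logarithmic factor is at least one.
    refine le_mul_of_one_le_right (by linarith) (Real.one_le_rpow ?_ ?_)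
    · linarith [Real.log_nonneg hu1.le]
    · nlinarith
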